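/- Let $\alpha>0$ and let $L:(0,\infty)\to(0,\infty)$ be slowly varying at infinity with $\sum_{n\ge1}L(n)n^{-1-\alpha}=1$; let $\tau_1$ be the inter-arrival time of the renewal process with $P(\tau_1=n)=L(n)n^{-1-\alpha}$, $n\ge 1$. Let $H\in(\tfrac12,1)$ and assume $\alpha+2H>2$. Put $K(x)=|x|^{2H-2}$. For $n\ge0$ let $\phi_n$ be the symmetric function given for $0<t_1<\dots<t_n<1$ by $$\phi_n(t_1,\dots,t_n)=\begin{cases}\dfrac{C_\alpha^n}{t_1^{1-\alpha}(t_2-t_1)^{1-\alpha}\cdots(t_n-t_{n-1})^{1-\alpha}},&0<\alpha<1,\\ (1/E[\tau_1])^n,&E[\tau_1]<\infty,\\ 1,&\alpha=1,\ E[\tau_1]=\infty,\end{cases}\qquad C_\alpha=\frac{\alpha\sin(\pi\alpha)}{\pi},$$ and for $m,k\ge 0$ let $\psi_{m,k}(t_1,\dots,t_m)$ be $\int_{[0,1]^k}\phi_{m+k}(t_1,\dots,t_{m+k})\,dt_{m+1}\cdots dt_{m+k}$ if $\alpha<1$, $(1/E[\tau_1])^{m+k}$ if $E[\tau_1]<\infty$,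 and $1$ if $\alpha=1$, $E[\tau_1]=\infty$. Let $|\mathcal H|$ be the space of measurable $f$ on $[0,1]$ with $\int_0^1\!\int_0^1|f(s)f(t)|K(s-t)\,ds\,dt<\infty$, and let $W=\{W(f)\}$ be a centered Gaussian family indexed by $|\mathcal H|$ (the isonormal process of the noise) with $E[W(f)W(g)]=\int_0^1\!\int_0^1 f(s)g(t)K(s-t)\,ds\,dt$. For a function $f$ of $n=2j+r$ variables its $j$-th trace is the function of $r$ variables $$\mathrm{Tr}^jf(t_1,\dots,t_r)=\int_{[0,1]^{2j}}f(s_1,\dots,s_{2j},t_1,\dots,t_r)\prod_{i=1}^jK(s_{2i}-s_{2i-1})\,ds,$$ and for a function $h$ of $r$ variables put $\|h\|^2_{|\mathcal H|^{\otimes r}}=\int_{[0,1]^{2r}}|h(t)h(t')|\prod_{i=1}^rK(t_i-t_i')\,dt\,dt'$. The multiple Stratonovich integral is $\mathbb I_n(\sum_ic_ig_i^{\otimes n})=\sum_ic_iW(g_i)^n$ for finite sums with $g_i\in|\mathcal H|$, $c_i\in\mathbb R$; in general $\mathbb I_n(f)$ is the $L^2$-limit of $\mathbb I_n(f_l)$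 for a sequence of such finite sums $f_l$ with $\|\mathrm{Tr}^j|f_l-f|\|_{|\mathcal H|^{\otimes(n-2j)}}\to0$ for all $0\le j\le n/2$. Then, for all integers $m,k\ge0$, the integrals $\mathbb I_m(\phi_m)$ and $\mathbb I_m(\psi_{m,k})$ exist in $L^2$, the integrals defining the numbers $\mathrm{Tr}^m\phi_{2m}$ and $\mathrm{Tr}^m\psi_{2m,2k}$ converge absolutely, and $$E[\mathbb I_m(\phi_m)^2]\le 2^m(m+1)!\,\mathrm{Tr}^m\phi_{2m},\qquad E[\mathbb I_m(\psi_{m,k})^2]\le 2^m(m+1)!\,\mathrm{Tr}^m\psi_{2m,2k}.$$ -/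

import Mathlib

open MeasureTheory ProbabilityTheory Filter Topology

noncomputable section

namespace Pinning

/-! ### The inter-arrival law and the kernels `φ` and `ψ` -/

/-- The inter-arrival law `P(τ₁ = n) = L(n) / n ^ (1 + α)`, `n ≥ 1`, of a persistent renewal
process, with `α > 0` and `L : (0, ∞) → (0, ∞)` slowly varying at infinity. Values of `L` at
non-positive arguments play no role. -/
structure RenewalLaw where
  α : ℝ
  L : ℝ → ℝ
  α_pos : 0 < α
  L_measurable : Measurable L
  L_pos : ∀ x, 0 < x → 0 < L x
  L_slow : ∀ a, 0 < a → Tendsto (fun t => L (a * t) / L t) atTop (𝓝 1)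
  persistent : HasSum (fun n : ℕ => L ((n : ℝ) + 1) / ((n : ℝ) + 1) ^ (1 + α)) 1

/-- `E[τ₁] = ∑_{n ≥ 1} n P(τ₁ = n)`, a value in `[0, ∞]`. -/
def RenewalLaw.mean (R : RenewalLaw) : ENNReal :=
  ∑' n : ℕ, ENNReal.ofReal
    (((n : ℝ) + 1) * (R.L ((n : ℝ) + 1) / ((n : ℝ) + 1) ^ (1 + R.α)))

/-- `C_α = α sin(π α) / π`. -/
def RenewalLaw.C (R : RenewalLaw) : ℝ := R.α * Real.sin (Real.pi * R.α) / Real.pi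

/-- The largest element of `{0} ∪ {t_j : t_j < t_i}`, i.e. the point just below `t_i`. -/
def pred {n : ℕ} (t : Fin n → ℝ) (i : Fin n) : ℝ :=
  (Finset.univ.filter fun j => t j < t i).fold max 0 t

/-- The function `φ_n`. In the case `α < 1` it is the symmetric function which for
`0 < t₁ < ⋯ < t_n < 1` equals `C_α ^ n / (t₁ ^ (1 - α) (t₂ - t₁) ^ (1 - α) ⋯)`; this and the
symmetry are `phi_of_strictMono` and `phi_comp_perm`. -/
def RenewalLaw.phi (R : RenewalLaw) (n : ℕ) (t : Fin n → ℝ) : ℝ :=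
  if R.α < 1 then R.C ^ n / ∏ i, (t i - pred t i) ^ (1 - R.α)
  else if R.mean ≠ ⊤ then (1 / R.mean.toReal) ^ n
  else 1

theorem RenewalLaw.phi_comp_perm (R : RenewalLaw) {n : ℕ} (t : Fin n → ℝ)
    (σ : Equiv.Perm (Fin n)) : R.phi n (t ∘ σ) = R.phi n t := by
  have hp : ∀ i, pred (t ∘ σ) i = pred t (σ i) := by
    intro i
    have h : (Finset.univ.filter fun j => t j < t (σ i))
        = (Finset.univ.filter fun j => t (σ j) < t (σ i)).map σ.toEmbedding := by
      ext j
      simp only [Finset.mem_filter, Finset.mem_univ, true_and, Finset.mem_map_equiv,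
        Equiv.apply_symm_apply]
    unfold pred
    rw [h, Finset.fold_map]
    rfl
  unfold RenewalLaw.phi
  simp only [hp, Function.comp_apply]
  rw [Equiv.prod_comp σ (fun i => (t i - pred t i) ^ (1 - R.α))]

theorem RenewalLaw.phi_of_strictMono (R : RenewalLaw) (hα : R.α < 1) {n : ℕ} (t : Fin n → ℝ)
    (ht : StrictMono t) (hpos : ∀ i, 0 < t i) :
    R.phi n t = R.C ^ n /
      ∏ i : Fin n, (t i - if i.val = 0 then 0 else t ⟨i.val - 1, by omega⟩) ^ (1 - R.α) := by
  have hp : ∀ i : Fin n, pred t i = if i.val = 0 then 0 else t ⟨i.val - 1, by omega⟩ := by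
    intro i
    unfold pred
    split_ifs with h
    · have : (Finset.univ.filter fun j => t j < t i) = ∅ := by
        ext j
        simp only [Finset.mem_filter, Finset.mem_univ, true_and, ht.lt_iff_lt, Fin.lt_def,
          Finset.notMem_empty, iff_false]
        omega
      rw [this, Finset.fold_empty]
    · apply le_antisymm
      · rw [Finset.fold_max_le]
        refine ⟨(hpos _).le, fun j hj => ?_⟩
        simp only [Finset.mem_filter, Finset.mem_univ, true_and, ht.lt_iff_lt, Fin.lt_def] at hj
        apply ht.monotone
        rw [Fin.le_def]
        simp only
        omega
      · rw [Finset.le_fold_max]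
        right
        refine ⟨⟨i.val - 1, by omega⟩, ?_, le_rfl⟩
        simp only [Finset.mem_filter, Finset.mem_univ, true_and, ht.lt_iff_lt, Fin.lt_def]
        omega
  unfold RenewalLaw.phi
  rw [if_pos hα]
  simp only [hp]

/-- Lebesgue measure on `[0, 1]`. -/
def unitMeas : Measure ℝ := volume.restrict (Set.Icc 0 1)

/-- Lebesgue measure on `[0, 1] ^ n`. -/
def cube (n : ℕ) : Measure (Fin n → ℝ) := Measure.pi fun _ => unitMeas

/-- The function `ψ_{m,k}`. -/
def RenewalLaw.psi (R : RenewalLaw) (m k : ℕ) (t : Fin m → ℝ) : ℝ :=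
  if R.α < 1 then ∫ x, R.phi (m + k) (Fin.append t x) ∂cube k
  else if R.mean ≠ ⊤ then (1 / R.mean.toReal) ^ (m + k)
  else 1

/-! ### The Gaussian noise -/

/-- The covariance kernel `K(x) = |x| ^ (2 H - 2)`. -/
def K (H x : ℝ) : ℝ := |x| ^ (2 * H - 2)

/-- The space `|𝓗|` of measurable functions on `[0, 1]` with
`∫∫ |f(s) f(t)| |s - t| ^ (2 H - 2) ds dt < ∞` (a function on `[0, 1]` is represented by a
function on `ℝ`, of which only the restriction to `[0, 1]` matters). It is dense in the Hilbert
space `𝓗`. -/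
def AbsH (H : ℝ) : Type :=
  {f : ℝ → ℝ // Measurable f ∧
    ∫⁻ s, ∫⁻ t, ‖f s‖ₑ * ‖f t‖ₑ * ENNReal.ofReal (K H (s - t)) ∂unitMeas ∂unitMeas < ⊤}

/-- `⟨f, g⟩_𝓗 = ∫∫ f(s) g(t) |s - t| ^ (2 H - 2) ds dt`. -/
def innerH (H : ℝ) (f g : AbsH H) : ℝ :=
  ∫ p : ℝ × ℝ, f.1 p.1 * g.1 p.2 * K H (p.1 - p.2) ∂(unitMeas.prod unitMeas)

/-- `W` is the isonormal Gaussian process of the noise: a centered Gaussian family with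
`E[W(f) W(g)] = ⟨f, g⟩_𝓗`, indexed by the dense subspace `|𝓗|` of `𝓗`, which determines it. -/
structure IsIsonormal {Ω : Type*} [MeasurableSpace Ω] (P : Measure Ω) (H : ℝ)
    (W : AbsH H → Ω → ℝ) : Prop where
  gaussian : IsGaussianProcess W P
  centered : ∀ f, ∫ ω, W f ω ∂P = 0
  covariance : ∀ f g, ∫ ω, W f ω * W g ω ∂P = innerH H f g

/-! ### Traces -/

/-- `∏_{i=1}^k K(s_{2i} - s_{2i-1})` (with indices starting at `0` in the code). -/
def pairKernel (H : ℝ) (k : ℕ) (s : Fin (2 * k) → ℝ) : ℝ :=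
  ∏ i : Fin k, K H (s ⟨2 * i.val + 1, by omega⟩ - s ⟨2 * i.val, by omega⟩)

/-- The integrand of the `k`-th trace at `t`, a function of `s ∈ [0, 1] ^ (2 k)`. -/
def traceIntegrand (H : ℝ) (k r : ℕ) (f : (Fin (2 * k + r) → ℝ) → ℝ) (t : Fin r → ℝ)
    (s : Fin (2 * k) → ℝ) : ℝ :=
  f (Fin.append s t) * pairKernel H k s

/-- The `k`-th order trace `Tr^k f`, a function of `r` variables, of a function `f` of `2 k + r`
variables. -/
def trace (H : ℝ) (k r : ℕ) (f : (Fin (2 * k + r) → ℝ) → ℝ) (t : Fin r → ℝ) : ℝ :=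
  ∫ s, traceIntegrand H k r f t s ∂cube (2 * k)

/-- `Tr^k |f|`, with values in `[0, ∞]`. -/
def absTrace (H : ℝ) (k r : ℕ) (f : (Fin (2 * k + r) → ℝ) → ℝ) (t : Fin r → ℝ) : ENNReal :=
  ∫⁻ s, ‖traceIntegrand H k r f t s‖ₑ ∂cube (2 * k)

/-- `‖Tr^k |f|‖²` in `|𝓗|^{⊗ r}`, where `f` is a function of `2 k + r` variables. -/
def absTraceNormSq (H : ℝ) (k r : ℕ) (f : (Fin (2 * k + r) → ℝ) → ℝ) : ENNReal :=
  ∫⁻ t, ∫⁻ t', absTrace H k r f t * absTrace H k r f t' *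
    ENNReal.ofReal (∏ i, K H (t i - t' i)) ∂cube r ∂cube r

/-! ### Multiple Stratonovich integrals -/

/-- The function `∑_g c_g g^{⊗ n}` given by a finite family of coefficients `c`. -/
def tensorPoly {H : ℝ} (n : ℕ) (c : AbsH H →₀ ℝ) (t : Fin n → ℝ) : ℝ :=
  c.sum fun g a => a * ∏ i, g.1 (t i)

/-- The multiple Stratonovich integral `∑_g c_g W(g) ^ n` of `∑_g c_g g^{⊗ n}`. -/
def tensorPolyInt {Ω : Type*} {H : ℝ} (W : AbsH H → Ω → ℝ) (n : ℕ) (c : AbsH H →₀ ℝ)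
    (ω : Ω) : ℝ :=
  c.sum fun g a => a * W g ω ^ n

/-- `X` is (a version of) the `n`-th multiple Stratonovich integral of the function `f`:
`X` is the `L²` limit of `∑_g c_g W(g) ^ n` along a sequence of functions `∑_g c_g g^{⊗ n}`
which converges to `f` together with all its traces, the `k`-th trace in `|𝓗|^{⊗ (n - 2 k)}`,
`0 ≤ k ≤ n / 2`. -/
def IsStratonovichIntegral {Ω : Type*} [MeasurableSpace Ω] (P : Measure Ω) {H : ℝ}
    (W : AbsH H → Ω → ℝ) (n : ℕ) (f : (Fin n → ℝ) → ℝ) (X : Ω → ℝ) : Prop :=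
  AEStronglyMeasurable f (cube n) ∧ MemLp X 2 P ∧
    ∃ c : ℕ → (AbsH H →₀ ℝ),
      (∀ (k r : ℕ) (h : n = 2 * k + r),
        Tendsto (fun j => absTraceNormSq H k r
          (fun t => tensorPoly n (c j) (t ∘ Fin.cast h) - f (t ∘ Fin.cast h))) atTop (𝓝 0)) ∧
      Tendsto (fun j => eLpNorm (fun ω => tensorPolyInt W n (c j) ω - X ω) 2 P) atTop (𝓝 0)

end Pinning

end

noncomputable section

namespace Pinning

/-! ### Product measures -/

/-! For $f=\sum_g c_g\,g^{\otimes m}$, Wick's formula expands $E[\mathbb I_m(f)^2]$ over the perfect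
matchings of two groups of $m$ points. A matching with $l$ pairs inside each group contributes the
integral of $f\otimes f$ against the kernels $K$ of its pairs, which is at most
$\|\mathrm{Tr}^l|f|\|^2$. Hence $E[\mathbb I_m(f)^2]\le\sum_l w_{m,l}\|\mathrm{Tr}^l|f|\|^2$, where
the weights sum to the number $(2m-1)!!\le 2^m m!$ of all matchings (`sum_wickWeight`,
`IsIsonormal.integral_tensorPolyInt_sq_le`).

The special feature of $\phi$ is `RenewalLaw.phi_mul_phi_le`: merging two sets of points shrinks the
gaps, so $\phi_m(a)\phi_m(b)\le\phi_{2m}(a\cup b)$ when $\alpha<1$, with equality for the constant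
kernels. Each $\|\mathrm{Tr}^l\phi_m\|^2$ is therefore at most $\mathrm{Tr}^m\phi_{2m}$, uniformly
in $l$ (`RenewalLaw.traceNormSq_psi_le`), and only the sum of the weights matters. The same
inequality under the integral over the extra variables handles $\psi$.

Finiteness of $\mathrm{Tr}^m\phi_{2m}$ for $\alpha<1$ also comes from gaps: the kernel of a pair is
at most the product of the kernels of the gaps below its two points. The integrand is then bounded
by a constant times the product of the gaps to the power $2H-2-(1-\alpha)>-1$, and this is
integrable by integrating out the largest point repeatedly (`lintegral_gapProd_lt_top`).

The passage from tensor polynomials to general $f$ rests on two facts. Positive definiteness of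
$K^{\otimes r}$, from an explicit factorization through indicators of intervals, gives a weighted
triangle inequality for the trace norms (`absTraceNormSq_add_le`). Tensor polynomials are dense
among symmetric functions with finite trace norms (`exists_tendsto_traceNormSq`), by truncation,
step functions, polarization and dominated convergence. -/

instance : IsProbabilityMeasure unitMeas := by
  constructor; simp [unitMeas]

instance (n : ℕ) : IsProbabilityMeasure (cube n) := by
  unfold cube; infer_instance

theorem measurePreserving_comp_equiv {ι κ E : Type*} [Fintype ι] [Fintype κ] [MeasurableSpace E]
    (μ : Measure E) [SigmaFinite μ] (e : ι ≃ κ) :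
    MeasurePreserving (fun (u : κ → E) => u ∘ e) (Measure.pi fun _ => μ)
      (Measure.pi fun _ => μ) := by
  have h := measurePreserving_piCongrLeft (α := fun _ : ι => E) (fun _ => μ) e.symm
  convert! h using 1
  ext u i
  rw [MeasurableEquiv.coe_piCongrLeft, Equiv.piCongrLeft_apply]
  simp

theorem measurePreserving_sumElim {ι κ τ E : Type*} [Fintype ι] [Fintype κ] [Fintype τ]
    [MeasurableSpace E] (μ : Measure E) [SigmaFinite μ] (e : τ ≃ ι ⊕ κ) :
    MeasurePreserving (fun p : (ι → E) × (κ → E) => Sum.elim p.1 p.2 ∘ e)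
      ((Measure.pi fun _ => μ).prod (Measure.pi fun _ => μ)) (Measure.pi fun _ => μ) := by
  have h := measurePreserving_sumPiEquivProdPi_symm (X := fun _ : ι ⊕ κ => E) (fun _ => μ)
  have := (measurePreserving_comp_equiv μ e).comp h
  convert! this using 1

theorem measurePreserving_append (p q : ℕ) :
    MeasurePreserving (fun x : (Fin p → ℝ) × (Fin q → ℝ) => Fin.append x.1 x.2)
      ((cube p).prod (cube q)) (cube (p + q)) := by
  have := measurePreserving_sumElim (τ := Fin (p + q)) unitMeas finSumFinEquiv.symm
  convert! this using 1
  ext x i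
  refine Fin.addCases (fun j => ?_) (fun j => ?_) i <;> simp

theorem lintegral_pi_prod {ι E : Type*} [Fintype ι] [MeasurableSpace E] (μ : Measure E)
    [SigmaFinite μ] (f : ι → E → ENNReal) (hf : ∀ i, Measurable (f i)) :
    ∫⁻ x, ∏ i, f i (x i) ∂(Measure.pi fun _ => μ) = ∏ i, ∫⁻ x, f i x ∂μ := by
  have key : ∀ (n : ℕ) (g : Fin n → E → ENNReal), (∀ i, Measurable (g i)) →
      ∫⁻ x, ∏ i, g i (x i) ∂(Measure.pi fun _ => μ) = ∏ i, ∫⁻ x, g i x ∂μ := by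
    intro n
    induction n with
    | zero => intro g _; simp
    | succ n ih =>
      intro g hg
      rw [← ((measurePreserving_piFinSuccAbove (fun _ : Fin (n + 1) => μ) 0).symm).lintegral_comp
        (by fun_prop)]
      simp_rw [MeasurableEquiv.piFinSuccAbove_symm_apply, Fin.insertNthEquiv,
            Fin.prod_univ_succ, Fin.insertNth_zero, Equiv.coe_fn_mk, Fin.cons_succ,
            Fin.cons_zero]
      rw [← ih (fun i => g i.succ) (fun i => hg _)]
      rw [← lintegral_prod_mul (hg 0).aemeasurable
        (Finset.univ.measurable_prod fun i _ =>
          (hg i.succ).comp (measurable_pi_apply i)).aemeasurable]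
      rfl
  let e := (Fintype.equivFin ι).symm
  rw [← (measurePreserving_comp_equiv μ e.symm).lintegral_comp (by fun_prop),
    ← e.prod_comp (fun i => ∫⁻ x, f i x ∂μ), ← key _ (fun i => f (e i)) (fun i => hf _)]
  refine lintegral_congr fun x => ?_
  rw [← e.prod_comp]
  simp

theorem pi_withDensity {ι E : Type*} [Fintype ι] [MeasurableSpace E] (μ : Measure E)
    [SigmaFinite μ] (f : E → ENNReal) (hf : Measurable f) [SigmaFinite (μ.withDensity f)] :
    (Measure.pi fun _ : ι => μ.withDensity f)
      = (Measure.pi fun _ : ι => μ).withDensity fun x => ∏ i, f (x i) := by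
  refine Measure.pi_eq fun s hs => ?_
  rw [withDensity_apply _ (MeasurableSet.univ_pi hs), ← lintegral_indicator
    (MeasurableSet.univ_pi hs)]
  have : ∀ i, (μ.withDensity f) (s i) = ∫⁻ x, (s i).indicator f x ∂μ := fun i => by
    rw [withDensity_apply _ (hs i), lintegral_indicator (hs i)]
  simp_rw [this]
  rw [← lintegral_pi_prod μ (fun i => (s i).indicator f) (fun i => hf.indicator (hs i))]
  refine lintegral_congr fun x => ?_
  classical
  by_cases hx : x ∈ Set.univ.pi s
  · rw [Set.indicator_of_mem hx]
    exact Finset.prod_congr rfl fun i _ => (Set.indicator_of_mem (hx i trivial) _).symm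
  · rw [Set.indicator_of_notMem hx]
    simp only [Set.mem_univ_pi, not_forall] at hx
    obtain ⟨i, hi⟩ := hx
    exact (Finset.prod_eq_zero (Finset.mem_univ i) (Set.indicator_of_notMem hi _)).symm

/-! ### The kernel `K` -/

theorem K_nonneg (H x : ℝ) : 0 ≤ K H x := Real.rpow_nonneg (abs_nonneg _) _

theorem K_neg (H x : ℝ) : K H (-x) = K H x := by simp [K]

theorem K_sub_comm (H x y : ℝ) : K H (x - y) = K H (y - x) := by
  rw [← K_neg, neg_sub]

@[fun_prop]
theorem measurable_K (H : ℝ) : Measurable (K H) := by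
  unfold K; fun_prop

/-- A nonzero real power of zero is zero by convention, so the kernel vanishes on the diagonal
instead of blowing up there. This settles the case of coinciding coordinates in `K_sub_le`. -/
theorem ofReal_K_zero {H : ℝ} (hH' : H < 1) : K H 0 = 0 := by
  unfold K; rw [abs_zero, Real.zero_rpow (by linarith)]

/-- The mass of `K (s - ·)` on `[0, 1]` is bounded uniformly in `s`. -/
theorem lintegral_K_le (H : ℝ) (s : ℝ) (hs : s ∈ Set.Icc (0:ℝ) 1) :
    ∫⁻ t, ENNReal.ofReal (K H (s - t)) ∂unitMeas
      ≤ ∫⁻ x in Set.Icc (-1:ℝ) 1, ENNReal.ofReal (K H x) := by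
  unfold unitMeas
  rw [← lintegral_indicator measurableSet_Icc, ← lintegral_indicator measurableSet_Icc]
  rw [← lintegral_sub_left_eq_self (fun x => (Set.Icc (-1:ℝ) 1).indicator _ x) s]
  refine lintegral_mono fun t => ?_
  by_cases ht : t ∈ Set.Icc (0:ℝ) 1
  · rw [Set.indicator_of_mem ht, Set.indicator_of_mem]
    simp only [Set.mem_Icc] at *
    constructor <;> linarith
  · rw [Set.indicator_of_notMem ht]; exact zero_le

/-- The exponent $2H-2$ exceeds $-1$. The bound is also used with $H$ replaced by $H-(1-\alpha)/2$,
in the estimate of the gaps. -/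
theorem lintegral_Icc_K_lt_top {H : ℝ} (hH : 1 / 2 < H) :
    ∫⁻ x in Set.Icc (-1:ℝ) 1, ENNReal.ofReal (K H x) < ⊤ := by
  have : IntegrableOn (K H) (Set.Icc (-1) 1) := by
    rw [integrableOn_Icc_iff_integrableOn_Ioc,
      ← intervalIntegrable_iff_integrableOn_Ioc_of_le (by norm_num)]
    have h1 : IntervalIntegrable (K H) volume 0 1 := by
      refine (intervalIntegral.intervalIntegrable_rpow' (r := 2 * H - 2) (by linarith)).congr ?_
      intro x hx
      simp only [Set.uIoc_of_le (zero_le_one (α := ℝ)), Set.mem_Ioc] at hx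
      simp only [K]; rw [abs_of_pos hx.1]
    have h2 : IntervalIntegrable (K H) volume (-1) 0 := by
      have := h1.comp_sub_left 0
      simp only [zero_sub, sub_zero, K_neg] at this
      exact this.symm
    exact h2.trans h1
  rw [← ofReal_integral_eq_lintegral_ofReal this (ae_of_all _ fun x => K_nonneg H x)]
  exact ENNReal.ofReal_lt_top

/-- The measure with density `K (x - y)` on the unit square. -/
def pairMeas (H : ℝ) : Measure (ℝ × ℝ) :=
  (unitMeas.prod unitMeas).withDensity fun p => ENNReal.ofReal (K H (p.1 - p.2))

theorem isFiniteMeasure_pairMeas {H : ℝ} (hH : 1 / 2 < H) : IsFiniteMeasure (pairMeas H) := by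
  constructor
  unfold pairMeas
  rw [withDensity_apply _ MeasurableSet.univ, setLIntegral_univ,
    lintegral_prod _ (by fun_prop)]
  refine lt_of_le_of_lt (lintegral_mono_ae (g := fun _ =>
    ∫⁻ x in Set.Icc (-1:ℝ) 1, ENNReal.ofReal (K H x)) ?_) ?_
  · unfold unitMeas
    filter_upwards [ae_restrict_mem measurableSet_Icc] with s hs
    exact lintegral_K_le H s hs
  · simpa using lintegral_Icc_K_lt_top hH

instance (H : ℝ) : SigmaFinite (pairMeas H) := by
  unfold pairMeas; infer_instance

theorem pi_pairMeas (H : ℝ) (ι : Type*) [Fintype ι] :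
    (Measure.pi fun _ : ι => pairMeas H) =
      (Measure.pi fun _ : ι => unitMeas.prod unitMeas).withDensity
        fun x => ∏ i, ENNReal.ofReal (K H ((x i).1 - (x i).2)) := by
  have : SigmaFinite ((unitMeas.prod unitMeas).withDensity
    fun p => ENNReal.ofReal (K H (p.1 - p.2))) := inferInstanceAs (SigmaFinite (pairMeas H))
  exact pi_withDensity (unitMeas.prod unitMeas) _ (by fun_prop)

/-! ### Pairs of coordinates -/

/-- Even and odd indices. -/
def evenOdd (m : ℕ) : Fin m ⊕ Fin m ≃ Fin (2 * m) where
  toFun := Sum.elim (fun i => ⟨2 * i.val, by omega⟩) (fun i => ⟨2 * i.val + 1, by omega⟩)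
  invFun j := if j.val % 2 = 0 then .inl ⟨j.val / 2, by omega⟩ else .inr ⟨j.val / 2, by omega⟩
  left_inv := by
    rintro (i | i)
    · simp
    · have : (2 * i.val + 1) % 2 ≠ 0 := by omega
      simp only [Sum.elim_inr, this, if_false]
      congr 1; ext; simp only; omega
  right_inv j := by
    simp only
    split_ifs <;> ext <;> simp <;> omega

/-- The point of `ℝ ^ (2 m)` whose consecutive pairs of coordinates are the given ones. -/
def flatten {m : ℕ} (w : Fin m → ℝ × ℝ) : Fin (2 * m) → ℝ :=
  Sum.elim (fun i => (w i).1) (fun i => (w i).2) ∘ (evenOdd m).symm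

theorem flatten_evenOdd {m : ℕ} (w : Fin m → ℝ × ℝ) :
    flatten w ∘ evenOdd m = Sum.elim (fun i => (w i).1) (fun i => (w i).2) := by
  ext x; simp [flatten]

theorem flatten_even {m : ℕ} (w : Fin m → ℝ × ℝ) (i : Fin m) :
    flatten w ⟨2 * i.val, by omega⟩ = (w i).1 := congrFun (flatten_evenOdd w) (.inl i)

theorem flatten_odd {m : ℕ} (w : Fin m → ℝ × ℝ) (i : Fin m) :
    flatten w ⟨2 * i.val + 1, by omega⟩ = (w i).2 := congrFun (flatten_evenOdd w) (.inr i)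

@[fun_prop]
theorem measurable_flatten {m : ℕ} : Measurable (flatten (m := m)) := by
  refine measurable_pi_iff.2 fun j => ?_
  unfold flatten
  simp only [Function.comp_apply]
  rcases (evenOdd m).symm j with i | i <;> simp only [Sum.elim_inl, Sum.elim_inr] <;> fun_prop

theorem measurePreserving_unzip (ι : Type*) [Fintype ι] :
    MeasurePreserving (fun (w : ι → ℝ × ℝ) => ((fun i => (w i).1), (fun i => (w i).2)))
      (Measure.pi fun _ => unitMeas.prod unitMeas)
      ((Measure.pi fun _ => unitMeas).prod (Measure.pi fun _ => unitMeas)) := by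
  have := measurePreserving_arrowProdEquivProdArrow ℝ ℝ ι (fun _ => unitMeas) (fun _ => unitMeas)
  convert! this using 1

theorem measurePreserving_flatten (m : ℕ) :
    MeasurePreserving (flatten (m := m)) (Measure.pi fun _ => unitMeas.prod unitMeas)
      (cube (2 * m)) :=
  (measurePreserving_sumElim unitMeas (evenOdd m).symm).comp (measurePreserving_unzip (Fin m))

theorem pairKernel_nonneg (H : ℝ) (k : ℕ) (s : Fin (2 * k) → ℝ) : 0 ≤ pairKernel H k s :=
  Finset.prod_nonneg fun _ _ => K_nonneg _ _

@[fun_prop]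
theorem measurable_pairKernel (H : ℝ) (k : ℕ) : Measurable (pairKernel H k) := by
  unfold pairKernel; fun_prop

theorem pairKernel_flatten (H : ℝ) (k : ℕ) (w : Fin k → ℝ × ℝ) :
    ENNReal.ofReal (pairKernel H k (flatten w)) =
      ∏ i, ENNReal.ofReal (K H ((w i).1 - (w i).2)) := by
  unfold pairKernel
  rw [ENNReal.ofReal_prod_of_nonneg fun _ _ => K_nonneg _ _]
  refine Finset.prod_congr rfl fun i _ => ?_
  rw [flatten_even, flatten_odd, K_sub_comm]

/-- Absorbing the kernels into the measure leaves a product measure over pairs, for which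
rearranging the pairs is a mere permutation of factors. -/
theorem lintegral_mul_pairKernel (H : ℝ) (k : ℕ) (F : (Fin (2 * k) → ℝ) → ENNReal)
    (hF : Measurable F) :
    ∫⁻ s, F s * ENNReal.ofReal (pairKernel H k s) ∂cube (2 * k)
      = ∫⁻ w, F (flatten w) ∂(Measure.pi fun _ : Fin k => pairMeas H) := by
  rw [← (measurePreserving_flatten k).lintegral_comp (by fun_prop), pi_pairMeas,
    lintegral_withDensity_eq_lintegral_mul _ (by fun_prop) (by fun_prop)]
  refine lintegral_congr fun w => ?_
  rw [Pi.mul_apply, pairKernel_flatten, mul_comm]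

theorem lintegral_lintegral_mul_prod_K (H : ℝ) (r : ℕ)
    (G : (Fin r → ℝ) → (Fin r → ℝ) → ENNReal) (hG : Measurable (Function.uncurry G)) :
    ∫⁻ t, ∫⁻ t', G t t' * ENNReal.ofReal (∏ i, K H (t i - t' i)) ∂cube r ∂cube r
      = ∫⁻ z, G (fun i => (z i).1) (fun i => (z i).2)
          ∂(Measure.pi fun _ : Fin r => pairMeas H) := by
  have hG' : Measurable fun p : (Fin r → ℝ) × (Fin r → ℝ) => G p.1 p.2 := hG
  rw [lintegral_lintegral (by fun_prop)]
  rw [show (cube r).prod (cube r) = (Measure.pi fun _ => unitMeas).prod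
    (Measure.pi fun _ => unitMeas) from rfl]
  rw [← (measurePreserving_unzip (Fin r)).lintegral_comp (by fun_prop), pi_pairMeas,
    lintegral_withDensity_eq_lintegral_mul _ (by fun_prop)
      (g := fun w : Fin r → ℝ × ℝ => G (fun i => (w i).1) (fun i => (w i).2))
      (hG'.comp (measurePreserving_unzip (Fin r)).measurable)]
  refine lintegral_congr fun w => ?_
  rw [Pi.mul_apply, ENNReal.ofReal_prod_of_nonneg fun _ _ => K_nonneg _ _, mul_comm]

/-! ### Trace norms as integrals over pairings -/

/-- The product of the measures `pairMeas` over `k + k + r` pairs. -/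
def pairingMeas (H : ℝ) (k r : ℕ) : Measure (Fin k ⊕ Fin k ⊕ Fin r → ℝ × ℝ) :=
  Measure.pi fun _ => pairMeas H

/-- The first half of the coordinates: the first `k` pairs, and one coordinate of each of the
last `r` pairs. -/
def leftHalf {k r : ℕ} (w : Fin k ⊕ Fin k ⊕ Fin r → ℝ × ℝ) : Fin (2 * k + r) → ℝ :=
  Fin.append (flatten fun i => w (.inl i)) fun i => (w (.inr (.inr i))).1

/-- The second half of the coordinates. -/
def rightHalf {k r : ℕ} (w : Fin k ⊕ Fin k ⊕ Fin r → ℝ × ℝ) : Fin (2 * k + r) → ℝ :=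
  Fin.append (flatten fun i => w (.inr (.inl i))) fun i => (w (.inr (.inr i))).2

@[fun_prop]
theorem measurable_append {p q : ℕ} :
    Measurable fun x : (Fin p → ℝ) × (Fin q → ℝ) => Fin.append x.1 x.2 :=
  (measurePreserving_append p q).measurable

@[fun_prop]
theorem measurable_leftHalf {k r : ℕ} : Measurable (leftHalf (k := k) (r := r)) :=
  measurable_append.comp (f := fun w : Fin k ⊕ Fin k ⊕ Fin r → ℝ × ℝ =>
    (flatten fun i => w (.inl i), fun i => (w (.inr (.inr i))).1))
    ((measurable_flatten.comp (by fun_prop)).prodMk (by fun_prop))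

@[fun_prop]
theorem measurable_rightHalf {k r : ℕ} : Measurable (rightHalf (k := k) (r := r)) :=
  measurable_append.comp (f := fun w : Fin k ⊕ Fin k ⊕ Fin r → ℝ × ℝ =>
    (flatten fun i => w (.inr (.inl i)), fun i => (w (.inr (.inr i))).2))
    ((measurable_flatten.comp (by fun_prop)).prodMk (by fun_prop))

theorem absTrace_eq (H : ℝ) (k r : ℕ) (f : (Fin (2 * k + r) → ℝ) → ℝ) (hf : Measurable f)
    (t : Fin r → ℝ) :
    absTrace H k r f t =
      ∫⁻ v, ‖f (Fin.append (flatten v) t)‖ₑ ∂(Measure.pi fun _ : Fin k => pairMeas H) := by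
  have h : Measurable fun s : Fin (2 * k) → ℝ => ‖f (Fin.append s t)‖ₑ :=
    (hf.comp (measurable_append.comp (f := fun s => (s, t)) (by fun_prop))).enorm
  rw [← lintegral_mul_pairKernel H k _ h]
  unfold absTrace traceIntegrand
  refine lintegral_congr fun s => ?_
  rw [enorm_mul, Real.enorm_eq_ofReal (pairKernel_nonneg _ _ _)]

theorem measurable_absTrace (H : ℝ) (k r : ℕ) (f : (Fin (2 * k + r) → ℝ) → ℝ)
    (hf : Measurable f) : Measurable (absTrace H k r f) := by
  unfold absTrace traceIntegrand
  refine Measurable.lintegral_prod_right'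
    (f := fun p : (Fin r → ℝ) × (Fin (2 * k) → ℝ) => ‖f (Fin.append p.2 p.1) * pairKernel H k p.2‖ₑ)
    (Measurable.enorm (Measurable.mul (hf.comp (measurable_append.comp (f := fun p :
      (Fin r → ℝ) × (Fin (2 * k) → ℝ) => (p.2, p.1)) (by fun_prop))) (by fun_prop)))

theorem measurable_sumElim {ι κ E : Type*} [MeasurableSpace E] :
    Measurable fun p : (ι → E) × (κ → E) => Sum.elim p.1 p.2 := by
  refine measurable_pi_iff.2 ?_
  rintro (i | i) <;> simp only [Sum.elim_inl, Sum.elim_inr] <;> fun_prop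

theorem lintegral_pi_sum {ι κ E : Type*} [Fintype ι] [Fintype κ] [MeasurableSpace E]
    (μ : Measure E) [SigmaFinite μ] (G : (ι ⊕ κ → E) → ENNReal) (hG : Measurable G) :
    ∫⁻ w, G w ∂(Measure.pi fun _ => μ) =
      ∫⁻ y, ∫⁻ x, G (Sum.elim x y) ∂(Measure.pi fun _ => μ) ∂(Measure.pi fun _ => μ) := by
  rw [← (measurePreserving_sumElim μ (Equiv.refl (ι ⊕ κ))).lintegral_comp hG,
    lintegral_prod_symm (fun p : (ι → E) × (κ → E) => G (Sum.elim p.1 p.2 ∘ Equiv.refl (ι ⊕ κ)))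
      (hG.comp (measurePreserving_sumElim μ (Equiv.refl (ι ⊕ κ))).measurable).aemeasurable]
  rfl

/-- The kernels of the two traces and of the $|\mathcal H|^{\otimes r}$ norm act on disjoint pairs
of variables, so Tonelli merges everything into a single integral over $k+k+r$ pairs. -/
theorem absTraceNormSq_eq (H : ℝ) (k r : ℕ) (f : (Fin (2 * k + r) → ℝ) → ℝ)
    (hf : Measurable f) :
    absTraceNormSq H k r f =
      ∫⁻ w, ‖f (leftHalf w)‖ₑ * ‖f (rightHalf w)‖ₑ ∂pairingMeas H k r := by
  have hm := measurable_absTrace H k r f hf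
  unfold absTraceNormSq
  rw [lintegral_lintegral_mul_prod_K H r (fun t t' => absTrace H k r f t * absTrace H k r f t')
    (by unfold Function.uncurry; fun_prop)]
  unfold pairingMeas
  have hf1 := (hf.comp (measurable_leftHalf (k := k) (r := r))).enorm
  have hf2 := (hf.comp (measurable_rightHalf (k := k) (r := r))).enorm
  simp only [Function.comp_def] at hf1 hf2
  rw [lintegral_pi_sum _ _ (by fun_prop), lintegral_pi_sum _ _ (Measurable.lintegral_prod_left'
    (f := fun p : (Fin k → ℝ × ℝ) × (Fin k ⊕ Fin r → ℝ × ℝ) =>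
      ‖f (leftHalf (Sum.elim p.1 p.2))‖ₑ * ‖f (rightHalf (Sum.elim p.1 p.2))‖ₑ)
      ((hf1.mul hf2).comp measurable_sumElim))]
  refine lintegral_congr fun z => ?_
  rw [absTrace_eq _ _ _ _ hf, absTrace_eq _ _ _ _ hf, mul_comm]
  have h1 : ∀ t : Fin r → ℝ, Measurable fun v : Fin k → ℝ × ℝ =>
      ‖f (Fin.append (flatten v) t)‖ₑ := fun t =>
    (hf.comp (measurable_append.comp (f := fun v => (flatten v, t)) (by fun_prop))).enorm
  rw [← lintegral_mul_const _ (h1 _)]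
  refine lintegral_congr fun v' => ?_
  rw [mul_comm, ← lintegral_mul_const _ (h1 _)]
  rfl

/-- The arrangement of the two halves inside a point of `ℝ ^ (2 m)`. -/
theorem exists_equiv_flatten {k r m : ℕ} (e : Fin m ≃ Fin k ⊕ Fin k ⊕ Fin r) :
    ∃ σ : Fin (2 * k + r) ⊕ Fin (2 * k + r) ≃ Fin (2 * m),
      ∀ w : Fin k ⊕ Fin k ⊕ Fin r → ℝ × ℝ,
        flatten (w ∘ e) ∘ σ = Sum.elim (leftHalf w) (rightHalf w) := by
  let τ : Fin (2 * k + r) ≃ (Fin k ⊕ Fin k) ⊕ Fin r :=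
    finSumFinEquiv.symm.trans (Equiv.sumCongr (evenOdd k).symm (Equiv.refl _))
  -- Regroups coordinates from "left half, right half" to "first entries of all pairs, second
  -- entries of all pairs": a trace pair lies within one half, a cross pair has its first entry in
  -- the left half and its second in the right.
  let ρ : ((Fin k ⊕ Fin k) ⊕ Fin r) ⊕ ((Fin k ⊕ Fin k) ⊕ Fin r) ≃
      (Fin k ⊕ Fin k ⊕ Fin r) ⊕ (Fin k ⊕ Fin k ⊕ Fin r) :=
    { toFun := Sum.elim
        (Sum.elim (Sum.elim (fun i => .inl (.inl i)) (fun i => .inr (.inl i)))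
          (fun i => .inl (.inr (.inr i))))
        (Sum.elim (Sum.elim (fun i => .inl (.inr (.inl i))) (fun i => .inr (.inr (.inl i))))
          (fun i => .inr (.inr (.inr i))))
      invFun := Sum.elim
        (Sum.elim (fun i => .inl (.inl (.inl i))) (Sum.elim (fun i => .inr (.inl (.inl i)))
          (fun i => .inl (.inr i))))
        (Sum.elim (fun i => .inl (.inl (.inr i))) (Sum.elim (fun i => .inr (.inl (.inr i)))
          (fun i => .inr (.inr i))))
      left_inv := by rintro (((i | i) | i) | ((i | i) | i)) <;> rfl
      right_inv := by rintro ((i | i | i) | (i | i | i)) <;> rfl }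
  refine ⟨(Equiv.sumCongr τ τ).trans (ρ.trans ((Equiv.sumCongr e.symm e.symm).trans (evenOdd m))),
    fun w => ?_⟩
  have hl : ∀ x, leftHalf w (τ.symm x) =
      Sum.elim (Sum.elim (fun i => (w (.inl i)).1) (fun i => (w (.inl i)).2))
        (fun i => (w (.inr (.inr i))).1) x := by
    rintro ((i | i) | i) <;> simp [τ, leftHalf, flatten]
  have hr : ∀ x, rightHalf w (τ.symm x) =
      Sum.elim (Sum.elim (fun i => (w (.inr (.inl i))).1) (fun i => (w (.inr (.inl i))).2))
        (fun i => (w (.inr (.inr i))).2) x := by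
    rintro ((i | i) | i) <;> simp [τ, rightHalf, flatten]
  have key : ∀ y, flatten (w ∘ e) (evenOdd m y) =
      Sum.elim (fun i => (w (e i)).1) (fun i => (w (e i)).2) y :=
    fun y => congrFun (flatten_evenOdd (w ∘ e)) y
  ext x
  rcases x with x | x
  · obtain ⟨x, rfl⟩ := τ.symm.surjective x
    simp only [Sum.elim_inl, hl, Function.comp_apply, Equiv.trans_apply, key]
    rcases x with ((i | i) | i) <;> simp [ρ]
  · obtain ⟨x, rfl⟩ := τ.symm.surjective x
    simp only [Sum.elim_inr, hr, Function.comp_apply, Equiv.trans_apply, key]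
    rcases x with ((i | i) | i) <;> simp [ρ]

theorem card_pairs {k r m : ℕ} (h : m = 2 * k + r) :
    Nonempty (Fin m ≃ Fin k ⊕ Fin k ⊕ Fin r) :=
  ⟨Fintype.equivOfCardEq (by simp; omega)⟩

theorem measurePreserving_flatten_comp {k r m : ℕ} (e : Fin m ≃ Fin k ⊕ Fin k ⊕ Fin r) :
    MeasurePreserving (fun w : Fin k ⊕ Fin k ⊕ Fin r → ℝ × ℝ => flatten (w ∘ e))
      (Measure.pi fun _ => unitMeas.prod unitMeas) (cube (2 * m)) :=
  (measurePreserving_flatten m).comp (measurePreserving_comp_equiv _ e)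

theorem pairingMeas_absolutelyContinuous (H : ℝ) (k r : ℕ) :
    pairingMeas H k r ≪ Measure.pi fun _ => unitMeas.prod unitMeas := by
  unfold pairingMeas
  rw [pi_pairMeas]
  exact withDensity_absolutelyContinuous _ _

theorem measurePreserving_comp_inl {ι κ τ : Type*} [Fintype ι] [Fintype κ] [Fintype τ]
    (σ : ι ⊕ κ ≃ τ) :
    MeasurePreserving (fun u : τ → ℝ => u ∘ σ ∘ Sum.inl)
      (Measure.pi fun _ => unitMeas) (Measure.pi fun _ => unitMeas) :=
  measurePreserving_fst.comp
    ((measurePreserving_sumPiEquivProdPi (X := fun _ : ι ⊕ κ => ℝ) fun _ => unitMeas).comp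
      (measurePreserving_comp_equiv unitMeas σ))

/-- Transfers almost everywhere statements on the cube to the pairing space, as dominated
convergence in the trace norms requires. -/
theorem quasiMeasurePreserving_leftHalf (H : ℝ) (k r : ℕ) :
    Measure.QuasiMeasurePreserving (leftHalf (k := k) (r := r)) (pairingMeas H k r)
      (cube (2 * k + r)) := by
  obtain ⟨e⟩ := card_pairs (k := k) (r := r) rfl
  obtain ⟨σ, hσ⟩ := exists_equiv_flatten e
  have h := ((measurePreserving_comp_inl σ).comp
    (measurePreserving_flatten_comp e)).quasiMeasurePreserving.mono_left
      (pairingMeas_absolutelyContinuous H k r)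
  convert! h using 1
  ext w i
  exact (congrFun (hσ w) (.inl i)).symm

theorem quasiMeasurePreserving_rightHalf (H : ℝ) (k r : ℕ) :
    Measure.QuasiMeasurePreserving (rightHalf (k := k) (r := r)) (pairingMeas H k r)
      (cube (2 * k + r)) := by
  obtain ⟨e⟩ := card_pairs (k := k) (r := r) rfl
  obtain ⟨σ, hσ⟩ := exists_equiv_flatten e
  have h := ((measurePreserving_comp_inl ((Equiv.sumComm _ _).trans σ)).comp
    (measurePreserving_flatten_comp e)).quasiMeasurePreserving.mono_left
      (pairingMeas_absolutelyContinuous H k r)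
  convert! h using 1
  ext w i
  exact (congrFun (hσ w) (.inr i)).symm

/-- Almost every point of the cube lies in `[0, 1] ^ n`. -/
theorem ae_mem_cube {ι : Type*} [Fintype ι] :
    ∀ᵐ t ∂(Measure.pi fun _ : ι => unitMeas), ∀ i, t i ∈ Set.Icc (0 : ℝ) 1 := by
  rw [ae_all_iff]
  intro i
  have : ∀ᵐ x ∂unitMeas, x ∈ Set.Icc (0 : ℝ) 1 := by
    unfold unitMeas; exact ae_restrict_mem measurableSet_Icc
  exact (Measure.quasiMeasurePreserving_eval (fun _ : ι => unitMeas) i).ae this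

/-- If `|f(a) f(b)| ≤ F(c)` whenever the coordinates of `c` are those of `a` and `b`, then the
trace norms of `f` are bounded by the full trace of `F`. -/
theorem absTraceNormSq_le {H : ℝ} {k r m : ℕ} (h : m = 2 * k + r)
    (f : (Fin (2 * k + r) → ℝ) → ℝ) (hf : Measurable f)
    (F : (Fin (2 * m) → ℝ) → ENNReal) (hF : Measurable F)
    (hfF : ∀ (σ : Fin (2 * k + r) ⊕ Fin (2 * k + r) ≃ Fin (2 * m)) (c : Fin (2 * m) → ℝ),
      (∀ i, c i ∈ Set.Icc (0 : ℝ) 1) →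
      ‖f (c ∘ σ ∘ Sum.inl)‖ₑ * ‖f (c ∘ σ ∘ Sum.inr)‖ₑ ≤ F c) :
    absTraceNormSq H k r f ≤ ∫⁻ s, F s * ENNReal.ofReal (pairKernel H m s) ∂cube (2 * m) := by
  obtain ⟨e⟩ := card_pairs h
  obtain ⟨σ, hσ⟩ := exists_equiv_flatten e
  rw [absTraceNormSq_eq H k r f hf, lintegral_mul_pairKernel H m F hF,
    ← (measurePreserving_comp_equiv (pairMeas H) e).lintegral_comp (by fun_prop)]
  refine lintegral_mono_ae ?_
  filter_upwards [pairingMeas_absolutelyContinuous H k r ((measurePreserving_flatten_comp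
    e).quasiMeasurePreserving.ae (ae_mem_cube (ι := Fin (2 * m))))] with w hw
  have := hfF σ (flatten (w ∘ e)) hw
  rw [← Function.comp_assoc, ← Function.comp_assoc, hσ w] at this
  exact this

/-! ### Positive definiteness of the kernel -/

/-- The measure over which indicators of intervals `[s, s + r]` are averaged to represent `K`. -/
def scaleMeas (H : ℝ) : Measure (ℝ × ℝ) :=
  ((volume.restrict (Set.Ioi 0)).withDensity
    fun r : ℝ => ENNReal.ofReal (r ^ (2 * H - 4))).prod volume

instance (H : ℝ) : SigmaFinite (scaleMeas H) := by
  unfold scaleMeas; infer_instance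

/-- The indicator function of `s ≤ u ≤ s + r`, at `p = (r, u)`. -/
def intervalInd (s : ℝ) (p : ℝ × ℝ) : ENNReal :=
  if s ≤ p.2 ∧ p.2 ≤ s + p.1 then 1 else 0

theorem measurable_intervalInd : Measurable fun x : ℝ × (ℝ × ℝ) => intervalInd x.1 x.2 := by
  unfold intervalInd
  exact Measurable.ite ((measurableSet_le (f := fun x : ℝ × (ℝ × ℝ) => x.1)
    (g := fun x => x.2.2) (by fun_prop) (by fun_prop)).inter
    (measurableSet_le (f := fun x : ℝ × (ℝ × ℝ) => x.2.2) (g := fun x => x.1 + x.2.1)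
      (by fun_prop) (by fun_prop))) measurable_const measurable_const

theorem lintegral_intervalInd_mul (s t r : ℝ) :
    ∫⁻ u, intervalInd s (r, u) * intervalInd t (r, u) = ENNReal.ofReal (r - |s - t|) := by
  have : ∀ u, intervalInd s (r, u) * intervalInd t (r, u) =
      (Set.Icc (max s t) (min s t + r)).indicator 1 u := by
    intro u
    simp only [intervalInd, Set.indicator_apply, Set.mem_Icc, max_le_iff, ← min_add_add_right,
      le_min_iff, mul_ite, mul_one, mul_zero, Pi.one_apply]
    split_ifs <;> first | rfl | tauto
  simp_rw [this]
  rw [lintegral_indicator_one measurableSet_Icc, Real.volume_Icc]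
  congr 1
  have := max_sub_min_eq_abs s t
  rw [abs_sub_comm] at this
  linarith

/-- The constant in the representation of `K`. -/
def scaleConst (H : ℝ) : ℝ := 1 / (2 - 2 * H) - 1 / (3 - 2 * H)

theorem scaleConst_pos {H : ℝ} (hH' : H < 1) : 0 < scaleConst H :=
  sub_pos.2 (one_div_lt_one_div_of_lt (by linarith) (by linarith))

/-- With $x=|s-t|$, the intervals of length $r$ overlap in length $(r-x)_+$, and $\int_x^\infty
(r-x)r^{2H-4}\,dr$ is a multiple of $x^{2H-2}$ by scaling; it converges at infinity because $H<1$.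
On the diagonal the left side is infinite whereas `K H 0` is zero, hence $s\ne t$. -/
theorem lintegral_intervalInd_eq {H : ℝ} (hH' : H < 1) {s t : ℝ} (hst : s ≠ t) :
    ∫⁻ p, intervalInd s p * intervalInd t p ∂scaleMeas H =
      ENNReal.ofReal (scaleConst H) * ENNReal.ofReal (K H (s - t)) := by
  have hx : 0 < |s - t| := abs_pos.2 (sub_ne_zero.2 hst)
  set x := |s - t| with hxd
  have hm : Measurable fun p : ℝ × ℝ => intervalInd s p * intervalInd t p :=
    (measurable_intervalInd.comp (f := fun p => (s, p)) (by fun_prop)).mul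
      (measurable_intervalInd.comp (f := fun p => (t, p)) (by fun_prop))
  unfold scaleMeas
  rw [lintegral_prod _ hm.aemeasurable]
  simp_rw [lintegral_intervalInd_mul, ← hxd]
  rw [lintegral_withDensity_eq_lintegral_mul _ (by fun_prop) (by fun_prop)]
  have h1 : ∫⁻ r in Set.Ioi 0, ((fun r : ℝ => ENNReal.ofReal (r ^ (2 * H - 4))) *
      fun r => ENNReal.ofReal (r - x)) r =
      ∫⁻ r in Set.Ioi x, ENNReal.ofReal (r ^ (2 * H - 3) - x * r ^ (2 * H - 4)) := by
    rw [← lintegral_indicator measurableSet_Ioi, ← lintegral_indicator measurableSet_Ioi]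
    refine lintegral_congr fun r => ?_
    by_cases hr : x < r
    · have h0 : 0 < r := hx.trans hr
      rw [Set.indicator_of_mem (show r ∈ Set.Ioi x from hr),
        Set.indicator_of_mem (show r ∈ Set.Ioi 0 from h0), Pi.mul_apply,
        ← ENNReal.ofReal_mul (Real.rpow_nonneg h0.le _)]
      congr 1
      rw [show 2 * H - 3 = (2 * H - 4) + 1 by ring, Real.rpow_add_one h0.ne']
      ring
    · rw [Set.indicator_of_notMem (show r ∉ Set.Ioi x from hr)]
      by_cases h0 : 0 < r
      · rw [Set.indicator_of_mem (show r ∈ Set.Ioi 0 from h0), Pi.mul_apply,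
          ENNReal.ofReal_of_nonpos (by linarith : r - x ≤ 0), mul_zero]
      · rw [Set.indicator_of_notMem (show r ∉ Set.Ioi 0 from h0)]
  rw [h1]
  have i1 : IntegrableOn (fun r : ℝ => r ^ (2 * H - 3)) (Set.Ioi x) :=
    integrableOn_Ioi_rpow_of_lt (by linarith) hx
  have i2 : IntegrableOn (fun r : ℝ => x * r ^ (2 * H - 4)) (Set.Ioi x) :=
    (integrableOn_Ioi_rpow_of_lt (by linarith) hx).const_mul x
  rw [← ofReal_integral_eq_lintegral_ofReal
    (f := fun r => r ^ (2 * H - 3) - x * r ^ (2 * H - 4)) (i1.sub i2), integral_sub i1 i2,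
    integral_const_mul, integral_Ioi_rpow_of_lt (by linarith) hx,
    integral_Ioi_rpow_of_lt (by linarith) hx, ← ENNReal.ofReal_mul (scaleConst_pos hH').le]
  · congr 1
    unfold scaleConst K
    rw [← hxd, show 2 * H - 3 + 1 = 2 * H - 2 by ring, show 2 * H - 4 + 1 = 2 * H - 3 by ring,
      show x ^ (2 * H - 2) = x ^ (2 * H - 3) * x by
        rw [← Real.rpow_add_one hx.ne']; congr 1; ring]
    have a1 : 2 * H - 2 ≠ 0 := by linarith
    have a2 : 2 * H - 3 ≠ 0 := by linarith
    have a3 : 2 - 2 * H ≠ 0 := by linarith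
    have a4 : 3 - 2 * H ≠ 0 := by linarith
    rw [show 2 * H - 2 = -(2 - 2 * H) by ring, show 2 * H - 3 = -(3 - 2 * H) by ring]
    field_simp
  · filter_upwards [ae_restrict_mem measurableSet_Ioi] with r hr
    have h0 : 0 < r := hx.trans hr
    rw [Pi.zero_apply, show 2 * H - 3 = (2 * H - 4) + 1 by ring,
      Real.rpow_add_one h0.ne']
    have := Real.rpow_nonneg h0.le (2 * H - 4)
    have hr' : x < r := hr
    nlinarith

/-- Young's inequality $2ab\le\varepsilon a^2+\varepsilon^{-1}b^2$. Keeping $\varepsilon$ free is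
what later yields the sharp factor in the limit. -/
theorem add_sq_le_weighted (a b : ENNReal) {ε : NNReal} (hε : ε ≠ 0) :
    (a + b) * (a + b) ≤ (1 + ε) * (a * a) + (1 + (ε⁻¹ : NNReal)) * (b * b) := by
  rcases eq_or_ne a ⊤ with rfl | ha
  · simp
  rcases eq_or_ne b ⊤ with rfl | hb
  · simp
  lift a to NNReal using ha
  lift b to NNReal using hb
  norm_cast
  rw [← NNReal.coe_le_coe]
  push_cast
  have h : (0:ℝ) < ε := lt_of_le_of_ne ε.2 (fun h => hε (NNReal.coe_eq_zero.1 h.symm))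
  have h2 : 0 ≤ (ε:ℝ)⁻¹ * (ε * a - b) ^ 2 := by positivity
  have h3 : (ε:ℝ)⁻¹ * (ε * a - b) ^ 2 = ε * (a * a) - 2 * (a * b) + (ε:ℝ)⁻¹ * (b * b) := by
    field_simp
    ring
  nlinarith

/-- Tonelli turns the quadratic form of a factorized kernel into an integral of squares. The
factorization is only needed almost everywhere, which disregards the diagonal of `K`. -/
theorem quadForm_eq {α υ : Type*} [MeasurableSpace α] [MeasurableSpace υ] (μ : Measure α)
    [SFinite μ] (η : Measure υ) [SFinite η] (Q : α → υ → ENNReal)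
    (hQ : Measurable (Function.uncurry Q)) (k : α → α → ENNReal) (c : ENNReal)
    (hk : ∀ᵐ t ∂μ, ∀ᵐ t' ∂μ, k t t' = c * ∫⁻ u, Q t u * Q t' u ∂η)
    (A : α → ENNReal) (hA : Measurable A) :
    ∫⁻ t, ∫⁻ t', A t * A t' * k t t' ∂μ ∂μ =
      c * ∫⁻ u, (∫⁻ t, A t * Q t u ∂μ) * (∫⁻ t, A t * Q t u ∂μ) ∂η := by
  have hQ' : Measurable fun p : α × υ => Q p.1 p.2 := hQ
  have hQ1 : ∀ t, Measurable (Q t) := fun t => hQ.comp (f := fun u => (t, u)) (by fun_prop)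
  have hQ2 : ∀ u, Measurable fun t => Q t u := fun u =>
    hQ.comp (f := fun t => (t, u)) (by fun_prop)
  have hI : Measurable fun u => ∫⁻ t, A t * Q t u ∂μ :=
    Measurable.lintegral_prod_left' (f := fun p : α × υ => A p.1 * Q p.1 p.2)
      ((hA.comp measurable_fst).mul hQ')
  have hAQ1 : ∀ t, Measurable fun u => A t * Q t u := fun t => (hQ1 t).const_mul _
  have hAQ2 : ∀ u, Measurable fun t => A t * Q t u := fun u => hA.mul (hQ2 u)
  have hAQ : Measurable fun p : α × υ => A p.1 * Q p.1 p.2 := (hA.comp measurable_fst).mul hQ'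
  calc _ = ∫⁻ t, ∫⁻ t', ∫⁻ u, c * ((A t * Q t u) * (A t' * Q t' u)) ∂η ∂μ ∂μ := by
        refine lintegral_congr_ae ?_
        filter_upwards [hk] with t ht
        refine lintegral_congr_ae ?_
        filter_upwards [ht] with t' ht'
        have m1 : Measurable fun u => Q t u * Q t' u := (hQ1 t).mul (hQ1 t')
        have m2 : Measurable fun u => A t * Q t u * (A t' * Q t' u) := (hAQ1 t).mul (hAQ1 t')
        rw [ht', lintegral_const_mul _ m2, mul_left_comm, ← lintegral_const_mul _ m1]
        congr 1
        refine lintegral_congr fun u => ?_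
        ring
    _ = ∫⁻ t, ∫⁻ u, c * ((A t * Q t u) * ∫⁻ t', A t' * Q t' u ∂μ) ∂η ∂μ := by
        refine lintegral_congr fun t => ?_
        rw [lintegral_lintegral_swap]
        · refine lintegral_congr fun u => ?_
          have m1 : Measurable fun t' => A t * Q t u * (A t' * Q t' u) := (hAQ2 u).const_mul _
          rw [lintegral_const_mul _ m1, lintegral_const_mul _ (hAQ2 u)]
        · refine Measurable.aemeasurable (f := fun p : α × υ =>
            c * ((A t * Q t p.2) * (A p.1 * Q p.1 p.2))) ?_
          exact (((hAQ1 t).comp measurable_snd).mul hAQ).const_mul _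
    _ = ∫⁻ u, ∫⁻ t, c * ((A t * Q t u) * ∫⁻ t', A t' * Q t' u ∂μ) ∂μ ∂η := by
        rw [lintegral_lintegral_swap]
        refine Measurable.aemeasurable (f := fun p : α × υ =>
            c * ((A p.1 * Q p.1 p.2) * ∫⁻ t', A t' * Q t' p.2 ∂μ)) ?_
        exact (hAQ.mul (hI.comp measurable_snd)).const_mul _
    _ = _ := by
        have m1 : Measurable fun u => (∫⁻ t, A t * Q t u ∂μ) * (∫⁻ t, A t * Q t u ∂μ) :=
          hI.mul hI
        rw [← lintegral_const_mul _ m1]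
        refine lintegral_congr fun u => ?_
        have m2 : Measurable fun t => A t * Q t u * (∫⁻ t, A t * Q t u ∂μ) :=
          (hAQ2 u).mul_const _
        rw [lintegral_const_mul _ m2, lintegral_mul_const _ (hAQ2 u)]

/-- Young's inequality applied to the squares under the integral over $u$. It plays the role of the
triangle inequality and needs no finiteness. -/
theorem quadForm_add_le {α υ : Type*} [MeasurableSpace α] [MeasurableSpace υ] (μ : Measure α)
    [SFinite μ] (η : Measure υ) [SFinite η] (Q : α → υ → ENNReal)
    (hQ : Measurable (Function.uncurry Q)) (k : α → α → ENNReal) (c : ENNReal)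
    (hk : ∀ᵐ t ∂μ, ∀ᵐ t' ∂μ, k t t' = c * ∫⁻ u, Q t u * Q t' u ∂η)
    (A B : α → ENNReal) (hA : Measurable A) (hB : Measurable B) {ε : NNReal} (hε : ε ≠ 0) :
    ∫⁻ t, ∫⁻ t', (A t + B t) * (A t' + B t') * k t t' ∂μ ∂μ ≤
      (1 + ε) * ∫⁻ t, ∫⁻ t', A t * A t' * k t t' ∂μ ∂μ +
      (1 + (ε⁻¹ : NNReal)) * ∫⁻ t, ∫⁻ t', B t * B t' * k t t' ∂μ ∂μ := by
  rw [quadForm_eq μ η Q hQ k c hk (fun t => A t + B t) (hA.add hB), quadForm_eq μ η Q hQ k c hk _ hA,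
    quadForm_eq μ η Q hQ k c hk _ hB]
  have hQ' : Measurable fun p : α × υ => Q p.1 p.2 := hQ
  have hQ2 : ∀ u, Measurable fun t => Q t u := fun u =>
    hQ.comp (f := fun t => (t, u)) (by fun_prop)
  have hI : ∀ A : α → ENNReal, Measurable A → Measurable fun u => ∫⁻ t, A t * Q t u ∂μ :=
    fun A hA => Measurable.lintegral_prod_left' (f := fun p : α × υ => A p.1 * Q p.1 p.2)
      ((hA.comp measurable_fst).mul hQ')
  rw [mul_left_comm _ c, mul_left_comm _ c, ← mul_add]
  gcongr
  have mI : ∀ A : α → ENNReal, Measurable A →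
      Measurable fun u => (∫⁻ t, A t * Q t u ∂μ) * (∫⁻ t, A t * Q t u ∂μ) :=
    fun A hA => (hI A hA).mul (hI A hA)
  rw [← lintegral_const_mul _ (mI A hA), ← lintegral_const_mul _ (mI B hB),
    ← lintegral_add_left ((mI A hA).const_mul _)]
  refine lintegral_mono fun u => ?_
  have : ∫⁻ t, (A t + B t) * Q t u ∂μ = ∫⁻ t, A t * Q t u ∂μ + ∫⁻ t, B t * Q t u ∂μ := by
    simp_rw [add_mul]
    exact lintegral_add_left (hA.mul (hQ2 u)) _
  simp only [this]
  exact add_sq_le_weighted _ _ hε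

theorem ae_ne_unitMeas (x : ℝ) : ∀ᵐ y ∂unitMeas, x ≠ y := by
  unfold unitMeas
  refine ae_restrict_of_ae ?_
  filter_upwards [Measure.ae_ne volume x] with y hy using hy.symm

/-- The tensor powers of `K` are positive definite, with an explicit factorization. -/
theorem ofReal_prod_K_eq {H : ℝ} (hH' : H < 1) (r : ℕ) (t : Fin r → ℝ) :
    ∀ᵐ t' ∂cube r, ENNReal.ofReal (∏ i, K H (t i - t' i)) =
      (ENNReal.ofReal (scaleConst H))⁻¹ ^ r *
        ∫⁻ u, (∏ i, intervalInd (t i) (u i)) * (∏ i, intervalInd (t' i) (u i))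
          ∂(Measure.pi fun _ : Fin r => scaleMeas H) := by
  have : ∀ᵐ t' ∂cube r, ∀ i, t i ≠ t' i := by
    rw [ae_all_iff]
    intro i
    exact (Measure.quasiMeasurePreserving_eval (fun _ : Fin r => unitMeas) i).ae
      (ae_ne_unitMeas (t i))
  filter_upwards [this] with t' ht'
  simp_rw [← Finset.prod_mul_distrib]
  rw [lintegral_pi_prod (scaleMeas H) (fun i p => intervalInd (t i) p * intervalInd (t' i) p)
    (fun i => (measurable_intervalInd.comp (f := fun p => (t i, p)) (by fun_prop)).mul
      (measurable_intervalInd.comp (f := fun p => (t' i, p)) (by fun_prop))),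
    Finset.prod_congr rfl fun i _ => lintegral_intervalInd_eq hH' (ht' i),
    Finset.prod_mul_distrib, Finset.prod_const, ENNReal.ofReal_prod_of_nonneg
      fun _ _ => K_nonneg _ _, ← mul_assoc, Finset.card_univ, Fintype.card_fin, ← mul_pow,
    ENNReal.inv_mul_cancel (by simpa using scaleConst_pos hH') ENNReal.ofReal_ne_top, one_pow,
    one_mul]

/-- The trace of the absolute value is pointwise subadditive, and the norm is a quadratic form with
the positive definite kernel $K^{\otimes r}$. -/
theorem absTraceNormSq_add_le {H : ℝ} (hH' : H < 1) (k r : ℕ)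
    (f g : (Fin (2 * k + r) → ℝ) → ℝ) (hf : Measurable f) (hg : Measurable g) {ε : NNReal}
    (hε : ε ≠ 0) :
    absTraceNormSq H k r (fun t => f t + g t) ≤
      (1 + ε) * absTraceNormSq H k r f + (1 + (ε⁻¹ : NNReal)) * absTraceNormSq H k r g := by
  have htr : ∀ t, absTrace H k r (fun t => f t + g t) t ≤
      absTrace H k r f t + absTrace H k r g t := by
    intro t
    rw [absTrace_eq H k r (fun t => f t + g t) (hf.add hg), absTrace_eq H k r _ hf, absTrace_eq H k r _ hg,
      ← lintegral_add_left]
    · exact lintegral_mono fun v => enorm_add_le _ _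
    · exact (hf.comp (measurable_append.comp (f := fun v => (flatten v, t)) (by fun_prop))).enorm
  refine le_trans ?_ (quadForm_add_le (cube r) (Measure.pi fun _ : Fin r => scaleMeas H)
    (fun t u => ∏ i, intervalInd (t i) (u i)) ?_
    (fun t t' => ENNReal.ofReal (∏ i, K H (t i - t' i)))
    ((ENNReal.ofReal (scaleConst H))⁻¹ ^ r) (ae_of_all _ fun t => ofReal_prod_K_eq hH' r t)
    _ _ (measurable_absTrace H k r f hf) (measurable_absTrace H k r g hg) hε)
  · unfold absTraceNormSq
    refine lintegral_mono fun t => lintegral_mono fun t' => ?_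
    gcongr <;> exact htr _
  · refine Finset.univ.measurable_prod fun i _ => ?_
    exact measurable_intervalInd.comp (f := fun p : (Fin r → ℝ) × (Fin r → ℝ × ℝ) =>
      (p.1 i, p.2 i)) (by fun_prop)

/-! ### The gaps between consecutive points -/

theorem pred_le_iff {n : ℕ} (t : Fin n → ℝ) (i : Fin n) (x : ℝ) :
    pred t i ≤ x ↔ 0 ≤ x ∧ ∀ j, t j < t i → t j ≤ x := by
  unfold pred
  rw [Finset.fold_max_le]
  simp

theorem pred_nonneg {n : ℕ} (t : Fin n → ℝ) (i : Fin n) : 0 ≤ pred t i :=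
  ((pred_le_iff t i _).1 le_rfl).1

theorem le_pred {n : ℕ} (t : Fin n → ℝ) {i j : Fin n} (h : t j < t i) : t j ≤ pred t i :=
  ((pred_le_iff t i _).1 le_rfl).2 j h

theorem pred_lt {n : ℕ} (t : Fin n → ℝ) {i : Fin n} (h : 0 < t i) : pred t i < t i := by
  unfold pred
  rw [Finset.fold_max_lt]
  exact ⟨h, fun j hj => by simpa using hj⟩

theorem pred_le {n : ℕ} (t : Fin n → ℝ) {i : Fin n} (h : 0 ≤ t i) : pred t i ≤ t i :=
  (pred_le_iff t i _).2 ⟨h, fun _ hj => hj.le⟩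

/-- Discarding points can only lower a predecessor, hence only widen the gaps. -/
theorem pred_comp_le {p n : ℕ} (c : Fin n → ℝ) (ι : Fin p → Fin n) (i : Fin p) :
    pred (c ∘ ι) i ≤ pred c (ι i) :=
  (pred_le_iff _ _ _).2 ⟨pred_nonneg _ _, fun j hj => le_pred c (j := ι j) hj⟩

@[fun_prop]
theorem measurable_pred {n : ℕ} (i : Fin n) : Measurable fun t : Fin n → ℝ => pred t i := by
  refine measurable_of_Iic fun x => ?_
  have : (fun t : Fin n → ℝ => pred t i) ⁻¹' Set.Iic x =
      {_t | 0 ≤ x} ∩ ⋂ j, ({t | t j < t i}ᶜ ∪ {t | t j ≤ x}) := by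
    ext t
    simp only [Set.mem_preimage, Set.mem_Iic, pred_le_iff, Set.mem_inter_iff, Set.mem_ofPred_eq,
      Set.mem_iInter, Set.mem_union, Set.mem_compl_iff, ← imp_iff_not_or]
  rw [this]
  refine (MeasurableSet.const _).inter (MeasurableSet.iInter fun j => ?_)
  exact (measurableSet_lt (by fun_prop) (by fun_prop)).compl.union
    (measurableSet_le (by fun_prop) (by fun_prop))

/-- `∏ᵢ K (tᵢ - pred tᵢ)`. -/
def gapProd (H : ℝ) (n : ℕ) (t : Fin n → ℝ) : ℝ := ∏ i, K H (t i - pred t i)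

theorem gapProd_nonneg (H : ℝ) {n : ℕ} (t : Fin n → ℝ) : 0 ≤ gapProd H n t :=
  Finset.prod_nonneg fun _ _ => K_nonneg _ _

@[fun_prop]
theorem measurable_gapProd (H : ℝ) (n : ℕ) : Measurable (gapProd H n) := by
  unfold gapProd; fun_prop

/-- The largest of `0` and the coordinates. -/
def top {n : ℕ} (t : Fin n → ℝ) : ℝ := Finset.univ.fold max 0 t

theorem top_le_iff {n : ℕ} (t : Fin n → ℝ) (x : ℝ) : top t ≤ x ↔ 0 ≤ x ∧ ∀ j, t j ≤ x := by
  unfold top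
  rw [Finset.fold_max_le]
  simp

/-- A point above all the others is nobody's predecessor, so it contributes one new factor and
leaves the other gaps unchanged. -/
theorem gapProd_insertNth (H : ℝ) {n : ℕ} (M : Fin (n + 1)) (x : ℝ) (t : Fin n → ℝ)
    (ht : ∀ j, t j < x) :
    gapProd H (n + 1) (M.insertNth (α := fun _ => ℝ) x t) = K H (top t - x) * gapProd H n t := by
  unfold gapProd
  rw [Fin.prod_univ_succAbove _ M]
  have h1 : pred (M.insertNth (α := fun _ => ℝ) x t) M = top t := by
    refine le_antisymm ((pred_le_iff _ _ _).2 ⟨((top_le_iff t _).1 le_rfl).1, fun j hj => ?_⟩)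
      ((top_le_iff _ _).2 ⟨pred_nonneg _ _, fun j => ?_⟩)
    · rcases Fin.eq_self_or_eq_succAbove M j with rfl | ⟨j, rfl⟩
      · exact absurd hj (lt_irrefl _)
      · rw [Fin.insertNth_apply_succAbove]
        exact ((top_le_iff t _).1 le_rfl).2 j
    · have := le_pred (M.insertNth (α := fun _ => ℝ) x t) (i := M) (j := M.succAbove j)
        (by simpa using ht j)
      simpa using this
  have h2 : ∀ i, pred (M.insertNth (α := fun _ => ℝ) x t) (M.succAbove i) = pred t i := by
    intro i
    refine le_antisymm ((pred_le_iff _ _ _).2 ⟨pred_nonneg _ _, fun j hj => ?_⟩)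
      ((pred_le_iff _ _ _).2 ⟨pred_nonneg _ _, fun j hj => ?_⟩)
    · rcases Fin.eq_self_or_eq_succAbove M j with rfl | ⟨j, rfl⟩
      · simp only [Fin.insertNth_apply_same, Fin.insertNth_apply_succAbove] at hj
        exact absurd hj (ht i).not_gt
      · simp only [Fin.insertNth_apply_succAbove] at hj ⊢
        exact le_pred t hj
    · have := le_pred (M.insertNth (α := fun _ => ℝ) x t) (i := M.succAbove i)
        (j := M.succAbove j) (by simpa using hj)
      simpa using this
  simp only [h1, h2, Fin.insertNth_apply_same, Fin.insertNth_apply_succAbove]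
  rw [K_sub_comm]

/-- The largest point occurs in a single factor, whose integral is bounded uniformly in the
remaining points; integrating it out gives an induction on $n$. -/
theorem lintegral_gapProd_lt_top {H : ℝ} (hH : 1 / 2 < H) (n : ℕ) :
    ∫⁻ t, ENNReal.ofReal (gapProd H n t) ∂cube n < ⊤ := by
  induction n with
  | zero => simp [gapProd]
  | succ n ih =>
    set D := ∫⁻ x in Set.Icc (-1:ℝ) 1, ENNReal.ofReal (K H x) with hD
    have hDt : D < ⊤ := lintegral_Icc_K_lt_top hH
    -- The sets where the coordinate `M` is maximal cover the space. They overlap at ties, which is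
    -- harmless for an upper bound.
    let S : Fin (n + 1) → Set (Fin (n + 1) → ℝ) := fun M => {t | ∀ j, t j ≤ t M}
    have hS : ∀ M, MeasurableSet (S M) := fun M => by
      have : S M = ⋂ j, {t | t j ≤ t M} := by ext; simp [S]
      rw [this]
      exact MeasurableSet.iInter fun j => measurableSet_le (by fun_prop) (by fun_prop)
    have hm : ∀ M, Measurable ((S M).indicator fun t => ENNReal.ofReal (gapProd H (n + 1) t)) :=
      fun M => Measurable.indicator (by fun_prop) (hS M)
    have h1 : ∀ t, ENNReal.ofReal (gapProd H (n + 1) t) ≤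
        ∑ M, (S M).indicator (fun t => ENNReal.ofReal (gapProd H (n + 1) t)) t := by
      intro t
      obtain ⟨M, -, hM⟩ := Finset.exists_max_image Finset.univ t ⟨0, Finset.mem_univ _⟩
      refine le_trans ?_ (Finset.single_le_sum (fun _ _ => zero_le) (Finset.mem_univ M))
      rw [Set.indicator_of_mem (show t ∈ S M from fun j => hM j (Finset.mem_univ j))]
    refine lt_of_le_of_lt (lintegral_mono h1) ?_
    rw [lintegral_finsetSum _ fun M _ => hm M]
    refine ENNReal.sum_lt_top.2 fun M _ => ?_
    have hp := (measurePreserving_piFinSuccAbove (fun _ : Fin (n + 1) => unitMeas) M).symm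
    unfold cube
    rw [← hp.lintegral_comp (hm M), lintegral_prod_symm (fun a =>
      (S M).indicator (fun t => ENNReal.ofReal (gapProd H (n + 1) t))
        ((MeasurableEquiv.piFinSuccAbove (fun x => ℝ) M).symm a))
      ((hm M).comp hp.measurable).aemeasurable]
    refine lt_of_le_of_lt (b := ∫⁻ t, D * ENNReal.ofReal (gapProd H n t) ∂cube n) ?_ ?_
    · refine lintegral_mono_ae ?_
      filter_upwards [ae_mem_cube (ι := Fin n)] with t ht
      have htop : top t ∈ Set.Icc (0:ℝ) 1 :=
        ⟨((top_le_iff t _).1 le_rfl).1, (top_le_iff t _).2 ⟨zero_le_one, fun j => (ht j).2⟩⟩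
      refine le_trans ?_ (mul_le_mul_left (lintegral_K_le H (top t) htop) _)
      rw [← lintegral_mul_const _ (by fun_prop)]
      refine lintegral_mono_ae ?_
      -- Off the null set of ties the maximum is strict, as `gapProd_insertNth` requires.
      have hne : ∀ᵐ x ∂unitMeas, ∀ j, t j ≠ x := by
        rw [ae_all_iff]
        exact fun j => ae_ne_unitMeas (t j)
      filter_upwards [hne] with x hx
      simp only [MeasurableEquiv.piFinSuccAbove_symm_apply, Fin.insertNthEquiv, Equiv.coe_fn_mk]
      by_cases h : M.insertNth (α := fun _ => ℝ) x t ∈ S M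
      · rw [Set.indicator_of_mem h, gapProd_insertNth H M x t,
          ENNReal.ofReal_mul (K_nonneg _ _)]
        intro j
        refine lt_of_le_of_ne ?_ (hx j)
        simpa using h (M.succAbove j)
      · rw [Set.indicator_of_notMem h]; exact zero_le
    · rw [lintegral_const_mul _ (by fun_prop)]
      exact ENNReal.mul_lt_top hDt ih

/-- The predecessor of the larger point is at least the smaller point, so the gap is at most the
distance, and `K` decreases with distance. The other factor is at least one because gaps are at most
one. -/
theorem K_sub_le {H : ℝ} (hH' : H < 1) {n : ℕ} (t : Fin n → ℝ)
    (ht : ∀ i, 0 < t i ∧ t i ≤ 1) (i j : Fin n) :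
    K H (t i - t j) ≤ K H (t i - pred t i) * K H (t j - pred t j) := by
  have one_le : ∀ i, 1 ≤ K H (t i - pred t i) := by
    intro i
    have h1 := pred_lt t (ht i).1
    have h2 := pred_nonneg t i
    unfold K
    rw [abs_of_pos (by linarith)]
    exact Real.one_le_rpow_of_pos_of_le_one_of_nonpos (by linarith) (by linarith [(ht i).2])
      (by linarith)
  have anti : ∀ i j, t j < t i → K H (t i - t j) ≤ K H (t i - pred t i) := by
    intro i j hij
    have h1 := pred_lt t (ht i).1
    have h2 := le_pred t hij
    unfold K
    rw [abs_of_pos (by linarith), abs_of_pos (by linarith)]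
    exact Real.rpow_le_rpow_of_nonpos (by linarith) (by linarith) (by linarith)
  rcases lt_trichotomy (t i) (t j) with h | h | h
  · rw [K_sub_comm]
    exact (anti j i h).trans (le_mul_of_one_le_left (K_nonneg _ _) (one_le i))
  · rw [h, sub_self, ofReal_K_zero hH']
    exact mul_nonneg (K_nonneg _ _) (K_nonneg _ _)
  · exact (anti i j h).trans (le_mul_of_one_le_right (K_nonneg _ _) (one_le j))

/-- Each coordinate of `s` belongs to exactly one pair, so `K_sub_le` uses each of its gap factors
once; the factors of the coordinates of `z` are at least one. -/
theorem pairKernel_le_gapProd {H : ℝ} (hH' : H < 1) {m k : ℕ} (s : Fin (2 * m) → ℝ)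
    (z : Fin k → ℝ) (ht : ∀ i, 0 < Fin.append s z i ∧ Fin.append s z i ≤ 1) :
    pairKernel H m s ≤ gapProd H (2 * m + k) (Fin.append s z) := by
  set t := Fin.append s z
  have hone : ∀ i, 1 ≤ K H (t i - pred t i) := by
    intro i
    have h1 := pred_lt t (ht i).1
    have h2 := pred_nonneg t i
    unfold K
    rw [abs_of_pos (by linarith)]
    exact Real.one_le_rpow_of_pos_of_le_one_of_nonpos (by linarith) (by linarith [(ht i).2])
      (by linarith)
  unfold gapProd pairKernel
  rw [Fin.prod_univ_add]
  refine le_trans ?_ (le_mul_of_one_le_right (Finset.prod_nonneg fun _ _ => K_nonneg _ _)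
    (Finset.one_le_prod fun i _ => hone _))
  rw [← (evenOdd m).prod_comp (fun j => K H (t (Fin.castAdd k j) - pred t (Fin.castAdd k j))),
    Fintype.prod_sum_type, ← Finset.prod_mul_distrib]
  refine Finset.prod_le_prod (fun _ _ => K_nonneg _ _) fun i _ => ?_
  have := K_sub_le hH' t ht (Fin.castAdd k (evenOdd m (.inl i)))
    (Fin.castAdd k (evenOdd m (.inr i)))
  refine le_trans (le_of_eq ?_) this
  rw [K_sub_comm]
  simp only [t, Fin.append_left]
  rfl

/-! ### The functions `φ` and `ψ` -/

theorem RenewalLaw.C_nonneg (R : RenewalLaw) (hα : R.α < 1) : 0 ≤ R.C := by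
  unfold RenewalLaw.C
  refine div_nonneg (mul_nonneg R.α_pos.le (Real.sin_nonneg_of_nonneg_of_le_pi ?_ ?_))
    Real.pi_pos.le
  · exact mul_nonneg Real.pi_pos.le R.α_pos.le
  · nlinarith [Real.pi_pos]

@[fun_prop]
theorem RenewalLaw.measurable_phi (R : RenewalLaw) (n : ℕ) : Measurable (R.phi n) := by
  unfold RenewalLaw.phi
  split_ifs <;> fun_prop

theorem RenewalLaw.phi_nonneg (R : RenewalLaw) {n : ℕ} (t : Fin n → ℝ) (ht : ∀ i, 0 ≤ t i) :
    0 ≤ R.phi n t := by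
  unfold RenewalLaw.phi
  split_ifs with h1 h2
  · exact div_nonneg (pow_nonneg (R.C_nonneg h1) _) (Finset.prod_nonneg fun i _ =>
      Real.rpow_nonneg (sub_nonneg.2 (pred_le t (ht i))) _)
  · positivity
  · exact zero_le_one

/-- A point at the origin has gap zero, and division by zero returns zero. -/
theorem RenewalLaw.phi_eq_zero (R : RenewalLaw) (hα : R.α < 1) {n : ℕ} (t : Fin n → ℝ)
    {i : Fin n} (hi : t i = 0) : R.phi n t = 0 := by
  unfold RenewalLaw.phi
  rw [if_pos hα, Finset.prod_eq_zero (Finset.mem_univ i), div_zero]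
  have h : pred t i = 0 := le_antisymm (hi ▸ pred_le t hi.ge) (pred_nonneg t i)
  rw [h, hi, sub_zero, Real.zero_rpow (by linarith)]

/-- Merging two sets of points decreases the gaps, hence increases `φ`. -/
theorem RenewalLaw.phi_mul_phi_le (R : RenewalLaw) {p q n : ℕ} (σ : Fin p ⊕ Fin q ≃ Fin n)
    (c : Fin n → ℝ) (hc : ∀ i, 0 ≤ c i) :
    R.phi p (c ∘ σ ∘ Sum.inl) * R.phi q (c ∘ σ ∘ Sum.inr) ≤ R.phi n c := by
  have hn : n = p + q := by simpa using (Fintype.card_congr σ).symm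
  by_cases hα : R.α < 1
  -- A zero coordinate makes one factor on the left vanish by the division convention. Otherwise all
  -- gaps are positive and the denominators can be compared.
  · by_cases h0 : ∃ i, c i = 0
    · obtain ⟨i, hi⟩ := h0
      refine le_trans (le_of_eq ?_) (R.phi_nonneg c hc)
      obtain ⟨x, rfl⟩ := σ.surjective i
      rcases x with x | x
      · rw [R.phi_eq_zero hα (c ∘ σ ∘ Sum.inl) hi, zero_mul]
      · rw [R.phi_eq_zero hα (c ∘ σ ∘ Sum.inr) hi, mul_zero]
    · push Not at h0
      have hpos : ∀ i, 0 < c i := fun i => lt_of_le_of_ne (hc i) (h0 i).symm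
      unfold RenewalLaw.phi
      simp only [if_pos hα]
      rw [div_mul_div_comm, ← pow_add, ← hn, ← σ.prod_comp, Fintype.prod_sum_type]
      have hg : ∀ i, 0 < (c i - pred c i) ^ (1 - R.α) := fun i =>
        Real.rpow_pos_of_pos (sub_pos.2 (pred_lt c (hpos i))) _
      refine div_le_div_of_nonneg_left (pow_nonneg (R.C_nonneg hα) _)
        (mul_pos (Finset.prod_pos fun _ _ => hg _) (Finset.prod_pos fun _ _ => hg _)) ?_
      have hle : ∀ {l : ℕ} (ι : Fin l → Fin n), ∏ i, (c (ι i) - pred c (ι i)) ^ (1 - R.α) ≤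
          ∏ i, ((c ∘ ι) i - pred (c ∘ ι) i) ^ (1 - R.α) := fun ι =>
        Finset.prod_le_prod (fun _ _ => (hg _).le) fun i _ =>
          Real.rpow_le_rpow (sub_pos.2 (pred_lt c (hpos _))).le
            (sub_le_sub_left (pred_comp_le c ι i) _) (by linarith)
      exact mul_le_mul (hle (σ ∘ Sum.inl)) (hle (σ ∘ Sum.inr))
        (Finset.prod_nonneg fun _ _ => (hg _).le)
        ((Finset.prod_nonneg fun _ _ => (hg _).le).trans (hle (σ ∘ Sum.inl)))
  · unfold RenewalLaw.phi
    simp only [if_neg hα]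
    split_ifs
    · rw [← pow_add, hn]
    · simp

/-- The gap exponents add up: $(2H-2)-(1-\alpha)=2H'-2$ with $H'=H-(1-\alpha)/2$. The condition
$H'>1/2$ is exactly $\alpha+2H>2$. -/
theorem RenewalLaw.phi_mul_pairKernel_le (R : RenewalLaw) (hα : R.α < 1) {H : ℝ} (hH' : H < 1)
    {m k : ℕ} (s : Fin (2 * m) → ℝ) (z : Fin k → ℝ)
    (ht : ∀ i, 0 ≤ Fin.append s z i ∧ Fin.append s z i ≤ 1) :
    R.phi (2 * m + k) (Fin.append s z) * pairKernel H m s ≤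
      R.C ^ (2 * m + k) * gapProd (H - (1 - R.α) / 2) (2 * m + k) (Fin.append s z) := by
  by_cases h0 : ∃ i, Fin.append s z i = 0
  · obtain ⟨i, hi⟩ := h0
    rw [R.phi_eq_zero hα _ hi, zero_mul]
    exact mul_nonneg (pow_nonneg (R.C_nonneg hα) _) (gapProd_nonneg _ _)
  push Not at h0
  have hpos : ∀ i, 0 < Fin.append s z i ∧ Fin.append s z i ≤ 1 := fun i =>
    ⟨lt_of_le_of_ne (ht i).1 (h0 i).symm, (ht i).2⟩
  refine (mul_le_mul_of_nonneg_left (pairKernel_le_gapProd hH' s z hpos)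
    (R.phi_nonneg _ fun i => (ht i).1)).trans (le_of_eq ?_)
  unfold RenewalLaw.phi gapProd
  rw [if_pos hα, div_mul_eq_mul_div, mul_div_assoc, ← Finset.prod_div_distrib]
  congr 1
  refine Finset.prod_congr rfl fun i _ => ?_
  have hg := sub_pos.2 (pred_lt _ (hpos i).1)
  unfold K
  rw [abs_of_pos hg, ← Real.rpow_sub hg]
  congr 1
  ring

/-- The function `ψ` with values in `[0, ∞]`. -/
def RenewalLaw.psiExt (R : RenewalLaw) (m k : ℕ) (t : Fin m → ℝ) : ENNReal :=
  ∫⁻ x, ‖R.phi (m + k) (Fin.append t x)‖ₑ ∂cube k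

theorem RenewalLaw.measurable_phi_append (R : RenewalLaw) (m k : ℕ) :
    Measurable fun p : (Fin m → ℝ) × (Fin k → ℝ) => R.phi (m + k) (Fin.append p.1 p.2) :=
  (R.measurable_phi (m + k)).comp measurable_append

theorem RenewalLaw.measurable_phi_append_right (R : RenewalLaw) {m k : ℕ} (t : Fin m → ℝ) :
    Measurable fun x : Fin k → ℝ => R.phi (m + k) (Fin.append t x) :=
  (R.measurable_phi_append m k).comp (f := fun x => (t, x)) (by fun_prop)

@[fun_prop]
theorem RenewalLaw.measurable_psiExt (R : RenewalLaw) (m k : ℕ) : Measurable (R.psiExt m k) :=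
  (R.measurable_phi_append m k).enorm.lintegral_prod_right'

@[fun_prop]
theorem RenewalLaw.measurable_psi (R : RenewalLaw) (m k : ℕ) : Measurable (R.psi m k) := by
  unfold RenewalLaw.psi
  split_ifs
  · exact ((R.measurable_phi_append m k).stronglyMeasurable.integral_prod_right').measurable
  · fun_prop
  · fun_prop

theorem RenewalLaw.psiExt_of_one_le (R : RenewalLaw) (hα : ¬ R.α < 1) (m k : ℕ) (t : Fin m → ℝ) :
    R.psiExt m k t = ‖R.psi m k t‖ₑ := by
  unfold RenewalLaw.psiExt RenewalLaw.psi RenewalLaw.phi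
  simp only [if_neg hα]
  split_ifs <;> simp

theorem RenewalLaw.enorm_psi_le (R : RenewalLaw) (m k : ℕ) (t : Fin m → ℝ) :
    ‖R.psi m k t‖ₑ ≤ R.psiExt m k t := by
  by_cases hα : R.α < 1
  · unfold RenewalLaw.psi RenewalLaw.psiExt
    rw [if_pos hα]
    exact enorm_integral_le_lintegral_enorm _
  · exact (R.psiExt_of_one_le hα m k t).ge

theorem append_mem {p q : ℕ} {s : Fin p → ℝ} {z : Fin q → ℝ} {S : Set ℝ} (hs : ∀ i, s i ∈ S)
    (hz : ∀ i, z i ∈ S) (i : Fin (p + q)) : Fin.append s z i ∈ S := by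
  refine Fin.addCases (fun j => ?_) (fun j => ?_) i
  · rw [Fin.append_left]; exact hs j
  · rw [Fin.append_right]; exact hz j

/-- This holds even where the inner integral diverges: the Bochner integral and `ENNReal.toReal`
both return zero there. -/
theorem RenewalLaw.psi_eq_toReal (R : RenewalLaw) (m k : ℕ) (t : Fin m → ℝ)
    (ht : ∀ i, t i ∈ Set.Icc (0:ℝ) 1) : R.psi m k t = (R.psiExt m k t).toReal := by
  by_cases hα : R.α < 1
  · unfold RenewalLaw.psi RenewalLaw.psiExt
    rw [if_pos hα, integral_eq_lintegral_of_nonneg_ae]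
    · congr 1
      refine lintegral_congr_ae ?_
      filter_upwards [ae_mem_cube (ι := Fin k)] with x hx
      rw [Real.enorm_eq_ofReal (R.phi_nonneg _ fun i => (append_mem ht hx i).1)]
    · filter_upwards [ae_mem_cube (ι := Fin k)] with x hx
      exact R.phi_nonneg _ fun i => (append_mem ht hx i).1
    · exact (R.measurable_phi_append_right t).aestronglyMeasurable
  · rw [R.psiExt_of_one_le hα, toReal_enorm, Real.norm_of_nonneg]
    unfold RenewalLaw.psi
    rw [if_neg hα]
    split_ifs <;> positivity

theorem RenewalLaw.psi_comp_perm (R : RenewalLaw) {m k : ℕ} (t : Fin m → ℝ)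
    (σ : Equiv.Perm (Fin m)) : R.psi m k (t ∘ σ) = R.psi m k t := by
  unfold RenewalLaw.psi
  split_ifs
  · refine integral_congr_ae (ae_of_all _ fun x => ?_)
    have : Fin.append (t ∘ σ) x = Fin.append t x ∘
        (finSumFinEquiv.symm.trans ((Equiv.sumCongr σ (Equiv.refl _)).trans finSumFinEquiv)) := by
      ext i
      refine Fin.addCases (fun j => ?_) (fun j => ?_) i <;> simp
    simp only [this]
    exact R.phi_comp_perm _ _
  · rfl
  · rfl

theorem RenewalLaw.psi_zero (R : RenewalLaw) (m : ℕ) : R.psi m 0 = R.phi m := by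
  ext t
  by_cases hα : R.α < 1
  · unfold RenewalLaw.psi
    rw [if_pos hα]
    have : ∀ x : Fin 0 → ℝ, R.phi (m + 0) (Fin.append t x) = R.phi m t := by
      intro x
      congr 1
      ext i
      exact Fin.append_left t x i
    simp_rw [this]
    simp
  · unfold RenewalLaw.psi RenewalLaw.phi
    simp [hα]

/-- The product of the two integrals is one integral over the joint extra variables, under which
`RenewalLaw.phi_mul_phi_le` merges the points. -/
theorem RenewalLaw.psiExt_mul_psiExt_le (R : RenewalLaw) {p q n k l k' : ℕ}
    (σ : Fin p ⊕ Fin q ≃ Fin n) (τ : Fin k ⊕ Fin l ≃ Fin k') (c : Fin n → ℝ)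
    (hc : ∀ i, c i ∈ Set.Icc (0:ℝ) 1) :
    R.psiExt p k (c ∘ σ ∘ Sum.inl) * R.psiExt q l (c ∘ σ ∘ Sum.inr) ≤ R.psiExt n k' c := by
  have hp := measurePreserving_sumElim unitMeas τ.symm
  unfold RenewalLaw.psiExt
  rw [← lintegral_prod_mul (R.measurable_phi_append_right _).enorm.aemeasurable
    (R.measurable_phi_append_right _).enorm.aemeasurable]
  unfold cube
  rw [← hp.lintegral_comp (R.measurable_phi_append_right c).enorm]
  refine lintegral_mono_ae ?_
  filter_upwards [hp.quasiMeasurePreserving.ae ae_mem_cube] with x hx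
  let ρ : Fin (p + k) ⊕ Fin (q + l) ≃ Fin (n + k') :=
    (Equiv.sumCongr finSumFinEquiv.symm finSumFinEquiv.symm).trans
      ((Equiv.sumSumSumComm _ _ _ _).trans ((Equiv.sumCongr σ τ).trans finSumFinEquiv))
  set z := Sum.elim x.1 x.2 ∘ τ.symm
  have e1 : Fin.append (c ∘ σ ∘ Sum.inl) x.1 = Fin.append c z ∘ ρ ∘ Sum.inl := by
    ext i
    refine Fin.addCases (fun j => ?_) (fun j => ?_) i <;> simp [ρ, z]
  have e2 : Fin.append (c ∘ σ ∘ Sum.inr) x.2 = Fin.append c z ∘ ρ ∘ Sum.inr := by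
    ext i
    refine Fin.addCases (fun j => ?_) (fun j => ?_) i <;> simp [ρ, z]
  have hz : ∀ i, 0 ≤ Fin.append c z i := fun i => (append_mem hc hx i).1
  have n1 : 0 ≤ R.phi (p + k) (Fin.append c z ∘ ρ ∘ Sum.inl) := R.phi_nonneg _ fun i => hz _
  have n2 : 0 ≤ R.phi (q + l) (Fin.append c z ∘ ρ ∘ Sum.inr) := R.phi_nonneg _ fun i => hz _
  rw [e1, e2, ← enorm_mul, Real.enorm_eq_ofReal (mul_nonneg n1 n2), Real.enorm_eq_ofReal (R.phi_nonneg _ hz)]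
  exact ENNReal.ofReal_le_ofReal (R.phi_mul_phi_le ρ _ hz)

theorem lintegral_pairKernel_lt_top {H : ℝ} (hH : 1 / 2 < H) (m : ℕ) :
    ∫⁻ s, ENNReal.ofReal (pairKernel H m s) ∂cube (2 * m) < ⊤ := by
  have := isFiniteMeasure_pairMeas hH
  have h := lintegral_mul_pairKernel H m (fun _ => 1) measurable_const
  simp only [one_mul] at h
  rw [h, lintegral_one]
  exact measure_lt_top _ _

/-- For $\alpha<1$ this is the integrability of the gap product with shifted exponent. For
$\alpha\ge1$ the kernels are constant and the total mass of `pairKernel` is finite. -/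
theorem RenewalLaw.lintegral_psiExt_mul_lt_top (R : RenewalLaw) {H : ℝ} (hH : 1 / 2 < H)
    (hH' : H < 1) (hA : 2 < R.α + 2 * H) (m k : ℕ) :
    ∫⁻ s, R.psiExt (2 * m) k s * ENNReal.ofReal (pairKernel H m s) ∂cube (2 * m) < ⊤ := by
  by_cases hα : R.α < 1
  · have hg := lintegral_gapProd_lt_top (H := H - (1 - R.α) / 2) (by linarith) (2 * m + k)
    have hm : Measurable fun p : (Fin (2 * m) → ℝ) × (Fin k → ℝ) =>
        ENNReal.ofReal (gapProd (H - (1 - R.α) / 2) (2 * m + k) (Fin.append p.1 p.2)) :=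
      ((measurable_gapProd _ _).comp measurable_append).ennreal_ofReal
    rw [← (measurePreserving_append (2 * m) k).lintegral_comp (by fun_prop),
      lintegral_prod _ hm.aemeasurable] at hg
    refine lt_of_le_of_lt ?_ (ENNReal.mul_lt_top
      (ENNReal.ofReal_lt_top (r := R.C ^ (2 * m + k))) hg)
    rw [← lintegral_const_mul _ hm.lintegral_prod_right']
    refine lintegral_mono_ae ?_
    filter_upwards [ae_mem_cube (ι := Fin (2 * m))] with s hs
    unfold RenewalLaw.psiExt
    have hms : Measurable fun z : Fin k → ℝ =>
        ENNReal.ofReal (gapProd (H - (1 - R.α) / 2) (2 * m + k) (Fin.append s z)) :=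
      hm.comp (f := fun z => (s, z)) (by fun_prop)
    rw [← lintegral_mul_const _ (R.measurable_phi_append_right s).enorm,
      ← lintegral_const_mul _ hms]
    refine lintegral_mono_ae ?_
    filter_upwards [ae_mem_cube (ι := Fin k)] with z hz
    have h := append_mem hs hz
    rw [Real.enorm_eq_ofReal (R.phi_nonneg _ fun i => (h i).1), ← ENNReal.ofReal_mul
      (R.phi_nonneg _ fun i => (h i).1), ← ENNReal.ofReal_mul (pow_nonneg (R.C_nonneg hα) _)]
    exact ENNReal.ofReal_le_ofReal (R.phi_mul_pairKernel_le hα hH' s z h)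
  · have hc : ∀ s, R.psiExt (2 * m) k s = R.psiExt (2 * m) k 0 := by
      intro s
      rw [R.psiExt_of_one_le hα, R.psiExt_of_one_le hα]
      unfold RenewalLaw.psi
      simp only [if_neg hα]
    simp_rw [hc]
    rw [lintegral_const_mul _ (by fun_prop), R.psiExt_of_one_le hα]
    exact ENNReal.mul_lt_top enorm_lt_top (lintegral_pairKernel_lt_top hH m)

/-! ### Gaussian moments -/

theorem integral_pow_gaussianReal_one (m : ℕ) :
    ∫ x, x ^ (2 * m) ∂gaussianReal 0 1 = ((2 * m - 1).doubleFactorial : ℝ) := by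
  rw [integral_gaussianReal_eq_integral_smul one_ne_zero]
  have h1 : ∀ x : ℝ, gaussianPDFReal 0 1 x • x ^ (2 * m) =
      (fun y : ℝ => (√(2 * Real.pi))⁻¹ * (y ^ (2 * (m:ℝ)) * Real.exp (-(1/2) * y ^ (2:ℝ)))) |x| := by
    intro x
    rw [gaussianPDFReal_def]
    simp only [smul_eq_mul, sub_zero, NNReal.coe_one, mul_one]
    have e1 : |x| ^ (2 * (m:ℝ)) = x ^ (2 * m) := by
      rw [show (2 * (m:ℝ)) = ((2 * m : ℕ) : ℝ) by push_cast; ring, Real.rpow_natCast, pow_mul,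
        sq_abs, ← pow_mul]
    have e2 : |x| ^ (2:ℝ) = x ^ 2 := by
      rw [show (2:ℝ) = ((2:ℕ):ℝ) by norm_num, Real.rpow_natCast, sq_abs]
    rw [e1, e2, show -x ^ 2 / 2 = -(1/2) * x ^ 2 by ring]
    ring
  simp_rw [h1]
  rw [integral_comp_abs (f := fun y : ℝ => (√(2 * Real.pi))⁻¹ *
    (y ^ (2 * (m:ℝ)) * Real.exp (-(1/2) * y ^ (2:ℝ)))), integral_const_mul,
    integral_rpow_mul_exp_neg_mul_rpow two_pos (by have : (0:ℝ) ≤ m := by positivity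
                                                   linarith) (by norm_num),
    show (2 * (m:ℝ) + 1) / 2 = m + 1 / 2 by ring, Real.Gamma_nat_add_half,
    show -(2 * (m:ℝ) + 1) / 2 = -(m + 1 / 2) by ring]
  have e3 : (1 / 2 : ℝ) ^ (-((m:ℝ) + 1 / 2)) = 2 ^ m * √2 := by
    rw [one_div, Real.inv_rpow two_pos.le, Real.rpow_neg two_pos.le, inv_inv,
      Real.rpow_add two_pos, Real.rpow_natCast, Real.sqrt_eq_rpow]
    norm_num
  rw [e3, Real.sqrt_mul two_pos.le]
  have a1 : √2 ≠ 0 := by positivity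
  have a2 : √Real.pi ≠ 0 := (Real.sqrt_pos.2 Real.pi_pos).ne'
  field_simp

theorem integral_pow_of_hasGaussianLaw {Ω : Type*} [MeasurableSpace Ω] {P : Measure Ω}
    {X : Ω → ℝ} (hX : HasGaussianLaw X P) (h0 : ∫ ω, X ω ∂P = 0) (m : ℕ) :
    ∫ ω, X ω ^ (2 * m) ∂P =
      ((2 * m - 1).doubleFactorial : ℝ) * (∫ ω, X ω ^ 2 ∂P) ^ m := by
  have hvar := variance_of_integral_eq_zero hX.aemeasurable h0
  set v := ∫ ω, X ω ^ 2 ∂P with hv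
  have hv0 : 0 ≤ v := integral_nonneg fun ω => sq_nonneg _
  have hmap : P.map X = (gaussianReal 0 1).map (fun x => √v * x) := by
    rw [hX.map_eq_gaussianReal, h0, hvar, gaussianReal_map_const_mul, mul_zero, mul_one]
    congr 1
    ext
    simp [Real.sq_sqrt hv0, Real.coe_toNNReal _ hv0]
  have e1 : ∫ ω, X ω ^ (2 * m) ∂P = ∫ x, x ^ (2 * m) ∂(P.map X) :=
    (integral_map hX.aemeasurable (continuous_pow (2 * m)).aestronglyMeasurable).symm
  rw [e1, hmap, integral_map (by fun_prop) (by fun_prop)]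
  simp_rw [mul_pow]
  rw [integral_const_mul, integral_pow_gaussianReal_one, pow_mul, Real.sq_sqrt hv0, mul_comm]

/-- Factor by factor, $(2m-1)!!\le(2m)!!=2^m m!$. At $m=0$ truncated subtraction gives $0!!=1$, the
intended value of $(-1)!!$. -/
theorem doubleFactorial_odd_le (m : ℕ) :
    (2 * m - 1).doubleFactorial ≤ 2 ^ m * (m + 1).factorial := by
  have : ∀ m : ℕ, (2 * m - 1).doubleFactorial ≤ (2 * m).doubleFactorial := by
    intro m
    induction m with
    | zero => simp
    | succ m ih =>
      rcases m with _ | m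
      · simp [Nat.doubleFactorial]
      · rw [show 2 * (m + 1 + 1) - 1 = (2 * (m + 1) - 1) + 2 by omega,
          show 2 * (m + 1 + 1) = 2 * (m + 1) + 2 by omega, Nat.doubleFactorial_add_two,
          Nat.doubleFactorial_add_two]
        exact Nat.mul_le_mul (by omega) ih
  refine (this m).trans ?_
  rw [Nat.doubleFactorial_two_mul]
  gcongr
  exact Nat.le_succ m

/-- The coefficient of `a ^ l b ^ l ρ ^ (m - 2 l)` in the coefficient of `s ^ m` in
`(a s ^ 2 + 2 ρ s + b) ^ m`. -/
def trinomialWeight (m l : ℕ) : ℝ :=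
  if 2 * l ≤ m then (m.choose (2 * l) : ℝ) * ((2 * l).choose l : ℝ) * 2 ^ (m - 2 * l) else 0

theorem trinomialWeight_nonneg (m l : ℕ) : 0 ≤ trinomialWeight m l := by
  unfold trinomialWeight; split_ifs <;> positivity

open Polynomial in
-- Degree $m$ arises by choosing each outer term $l$ times and the middle term $m-2l$ times. The
-- proof groups the outer terms together and expands two binomials.
theorem coeff_trinomial (a ρ b : ℝ) (m : ℕ) :
    ((C a * X ^ 2 + C (2 * ρ) * X + C b) ^ m : ℝ[X]).coeff m =
      ∑ l ∈ Finset.range (m + 1),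
        trinomialWeight m l * (a ^ l * b ^ l * ρ ^ (m - 2 * l)) := by
  have h2 : ∀ i n : ℕ, ((C a * X ^ 2 + C b) ^ i : ℝ[X]).coeff n =
      ∑ l ∈ Finset.range (i + 1), if n = 2 * l then a ^ l * b ^ (i - l) * (i.choose l : ℝ) else 0 := by
    intro i n
    rw [add_pow, finsetSum_coeff]
    refine Finset.sum_congr rfl fun l _ => ?_
    rw [mul_pow, ← pow_mul, ← C_pow, ← C_pow, ← C_eq_natCast,
      show C (a ^ l) * X ^ (2 * l) * C (b ^ (i - l)) * C (i.choose l : ℝ) =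
        C (a ^ l * b ^ (i - l) * (i.choose l : ℝ)) * X ^ (2 * l) by simp only [C_mul]; ring,
      coeff_C_mul_X_pow]
  rw [show (C a * X ^ 2 + C (2 * ρ) * X + C b : ℝ[X]) =
    (C a * X ^ 2 + C b) + C (2 * ρ) * X by ring, add_pow, finsetSum_coeff]
  have h3 : ∀ i ∈ Finset.range (m + 1),
      ((C a * X ^ 2 + C b) ^ i * (C (2 * ρ) * X) ^ (m - i) * (m.choose i : ℝ[X])).coeff m =
      ∑ l ∈ Finset.range (m + 1), if i = 2 * l then
        a ^ l * b ^ l * (2 * ρ) ^ (m - 2 * l) * (m.choose (2 * l) : ℝ) * ((2 * l).choose l : ℝ)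
        else 0 := by
    intro i hi
    have him : i ≤ m := by simpa [Nat.lt_succ_iff] using hi
    rw [mul_pow, ← C_pow, ← C_eq_natCast,
      show (C a * X ^ 2 + C b) ^ i * (C ((2 * ρ) ^ (m - i)) * X ^ (m - i)) * C (m.choose i : ℝ) =
        C ((2 * ρ) ^ (m - i) * (m.choose i : ℝ)) * ((C a * X ^ 2 + C b) ^ i * X ^ (m - i)) by
          simp only [C_mul]; ring,
      coeff_C_mul, coeff_mul_X_pow', if_pos (Nat.sub_le m i), show m - (m - i) = i by omega, h2,
      Finset.mul_sum]
    have hsub : Finset.range (i + 1) ⊆ Finset.range (m + 1) :=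
      Finset.range_mono (by omega)
    rw [← Finset.sum_subset hsub]
    · refine Finset.sum_congr rfl fun l _ => ?_
      split_ifs with h
      · subst h
        rw [show 2 * l - l = l by omega]
        ring
      · rw [mul_zero]
    · intro l _ hl
      rw [if_neg]
      intro h
      apply hl
      simp only [Finset.mem_range]
      omega
  rw [Finset.sum_congr rfl h3, Finset.sum_comm]
  refine Finset.sum_congr rfl fun l _ => ?_
  rw [Finset.sum_ite_eq']
  simp only [Finset.mem_range, Nat.lt_succ_iff, trinomialWeight]
  split_ifs
  · rw [mul_pow]; ring
  · ring

open Polynomial in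
-- At $a=\rho=b=1$ the trinomial is $(X+1)^2$.
theorem sum_trinomialWeight (m : ℕ) :
    ∑ l ∈ Finset.range (m + 1), trinomialWeight m l = ((2 * m).choose m : ℝ) := by
  have h := coeff_trinomial 1 1 1 m
  rw [show (C 1 * X ^ 2 + C (2 * 1) * X + C 1 : ℝ[X]) = (X + 1) ^ 2 by
    simp only [mul_one, C_1, show (C 2 : ℝ[X]) = 2 from rfl]; ring, ← pow_mul, coeff_X_add_one_pow] at h
  rw [h]
  simp

theorem integrable_pow_mul_pow {Ω : Type*} [MeasurableSpace Ω] {P : Measure Ω}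
    [IsProbabilityMeasure P] {X Y : Ω → ℝ}
    (hX : HasGaussianLaw X P) (hY : HasGaussianLaw Y P) (p q : ℕ) :
    Integrable (fun ω => X ω ^ p * Y ω ^ q) P := by
  have key : ∀ {Z : Ω → ℝ}, HasGaussianLaw Z P → ∀ p : ℕ, MemLp (fun ω => Z ω ^ p) 2 P := by
    intro Z hZ p
    rw [memLp_two_iff_integrable_sq (hZ.aemeasurable.pow_const p).aestronglyMeasurable]
    rcases Nat.eq_zero_or_pos p with rfl | hp
    · simp
    · have := (hZ.memLp (p := ((2 * p : ℕ) : ENNReal)) (ENNReal.natCast_ne_top _)).integrable_norm_pow (by omega)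
      refine this.congr (ae_of_all _ fun ω => ?_)
      simp only [Real.norm_eq_abs]
      rw [pow_mul, sq_abs, ← pow_mul, ← pow_mul, mul_comm]
  exact (key hX p).integrable_mul (key hY q)

open Polynomial in
/-- Wick's formula for `E[X ^ m Y ^ m]`. -/
theorem choose_mul_integral_pow_mul_pow {Ω : Type*} [MeasurableSpace Ω] {P : Measure Ω}
    [IsProbabilityMeasure P] {X Y : Ω → ℝ} (hXY : HasGaussianLaw (fun ω => (X ω, Y ω)) P)
    (hX0 : ∫ ω, X ω ∂P = 0) (hY0 : ∫ ω, Y ω ∂P = 0) (m : ℕ) :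
    ((2 * m).choose m : ℝ) * ∫ ω, X ω ^ m * Y ω ^ m ∂P =
      ((2 * m - 1).doubleFactorial : ℝ) * ∑ l ∈ Finset.range (m + 1), trinomialWeight m l *
        ((∫ ω, X ω * X ω ∂P) ^ l * (∫ ω, Y ω * Y ω ∂P) ^ l *
          (∫ ω, X ω * Y ω ∂P) ^ (m - 2 * l)) := by
  have hX := hXY.fst
  have hY := hXY.snd
  set a := ∫ ω, X ω * X ω ∂P
  set b := ∫ ω, Y ω * Y ω ∂P
  set ρ := ∫ ω, X ω * Y ω ∂P
  have ixx : Integrable (fun ω => X ω * X ω) P := by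
    simpa using integrable_pow_mul_pow hX hX 1 1
  have iyy : Integrable (fun ω => Y ω * Y ω) P := by
    simpa using integrable_pow_mul_pow hY hY 1 1
  have ixy : Integrable (fun ω => X ω * Y ω) P := by
    simpa using integrable_pow_mul_pow hX hY 1 1
  -- Both sides, evaluated at $s$, equal $E[(sX+Y)^{2m}]$: the left by the binomial theorem, the
  -- right because $sX+Y$ is centered Gaussian with variance $as^2+2\rho s+b$. Wick's formula is the
  -- comparison of the coefficients of $s^m$.
  have hpoly : (∑ p ∈ Finset.range (2 * m + 1),
      Polynomial.C (((2 * m).choose p : ℝ) * ∫ ω, X ω ^ p * Y ω ^ (2 * m - p) ∂P) * Polynomial.X ^ p) =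
      Polynomial.C ((2 * m - 1).doubleFactorial : ℝ) *
        (Polynomial.C a * Polynomial.X ^ 2 + Polynomial.C (2 * ρ) * Polynomial.X
          + Polynomial.C b) ^ m := by
    refine Polynomial.funext fun s => ?_
    simp only [eval_finsetSum, eval_mul, eval_C, eval_pow, eval_X, eval_add]
    have hL : HasGaussianLaw (fun ω => s * X ω + Y ω) P := by
      have := hXY.map_fun (s • ContinuousLinearMap.fst ℝ ℝ ℝ + ContinuousLinearMap.snd ℝ ℝ ℝ)
      simpa using this
    have h0 : ∫ ω, (s * X ω + Y ω) ∂P = 0 := by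
      rw [integral_add (hX.integrable.const_mul s) hY.integrable, integral_const_mul, hX0, hY0]
      simp
    have hv : ∫ ω, (s * X ω + Y ω) ^ 2 ∂P = a * s ^ 2 + 2 * ρ * s + b := by
      have : ∀ ω, (s * X ω + Y ω) ^ 2 =
          (s ^ 2 * (X ω * X ω) + (2 * s) * (X ω * Y ω)) + Y ω * Y ω := fun ω => by ring
      simp_rw [this]
      rw [integral_add (f := fun ω => s ^ 2 * (X ω * X ω) + (2 * s) * (X ω * Y ω))
        ((ixx.const_mul _).add (ixy.const_mul _)) iyy, integral_add (ixx.const_mul _) (ixy.const_mul _), integral_const_mul, integral_const_mul]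
      ring
    rw [← hv, ← integral_pow_of_hasGaussianLaw hL h0]
    simp_rw [add_pow]
    have hi := fun p => integrable_pow_mul_pow hX hY p (2 * m - p)
    have hre : ∀ p ω, (s * X ω) ^ p * Y ω ^ (2 * m - p) * ((2 * m).choose p : ℝ) =
        (s ^ p * ((2 * m).choose p : ℝ)) * (X ω ^ p * Y ω ^ (2 * m - p)) := fun p ω => by ring
    simp_rw [hre]
    rw [integral_finsetSum _ fun p _ => (hi p).const_mul _]
    refine Finset.sum_congr rfl fun p _ => ?_
    rw [integral_const_mul]
    ring
  have hc := congrArg (fun p => Polynomial.coeff p m) hpoly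
  simp only [finsetSum_coeff, coeff_C_mul, coeff_X_pow, mul_ite, mul_one, mul_zero] at hc
  rw [coeff_trinomial, Finset.sum_ite_eq, if_pos (by simp; omega)] at hc
  rw [← hc, show 2 * m - m = m by omega]

/-! ### Second moments of Stratonovich integrals of tensor polynomials -/

theorem lintegral_pairMeas (H : ℝ) (G : ℝ × ℝ → ENNReal) (hG : Measurable G) :
    ∫⁻ p, G p ∂pairMeas H =
      ∫⁻ s, ∫⁻ t, G (s, t) * ENNReal.ofReal (K H (s - t)) ∂unitMeas ∂unitMeas := by
  unfold pairMeas
  rw [lintegral_withDensity_eq_lintegral_mul _ (by fun_prop) hG, lintegral_prod _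
    (by fun_prop)]
  simp_rw [Pi.mul_apply, mul_comm (ENNReal.ofReal _)]

/-- The mixed term is dominated by the quadratic form of $|f|+|g|$, which is finite by positive
definiteness. -/
theorem AbsH.integrable_mul {H : ℝ} (hH' : H < 1) (f g : AbsH H) :
    Integrable (fun p : ℝ × ℝ => f.1 p.1 * g.1 p.2) (pairMeas H) := by
  have hf := f.2.1
  have hg := g.2.1
  have hm : Measurable fun p : ℝ × ℝ => f.1 p.1 * g.1 p.2 :=
    (hf.comp measurable_fst).mul (hg.comp measurable_snd)
  refine ⟨hm.aestronglyMeasurable, ?_⟩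
  unfold HasFiniteIntegral
  rw [lintegral_pairMeas H _ hm.enorm]
  have hk : ∀ᵐ s ∂unitMeas, ∀ᵐ t ∂unitMeas, ENNReal.ofReal (K H (s - t)) =
      (ENNReal.ofReal (scaleConst H))⁻¹ * ∫⁻ u, intervalInd s u * intervalInd t u ∂scaleMeas H := by
    refine ae_of_all _ fun s => ?_
    filter_upwards [ae_ne_unitMeas s] with t ht
    rw [lintegral_intervalInd_eq hH' ht, ← mul_assoc, ENNReal.inv_mul_cancel
      (by simpa using scaleConst_pos hH') ENNReal.ofReal_ne_top, one_mul]
  have h := quadForm_add_le unitMeas (scaleMeas H) intervalInd measurable_intervalInd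
    (fun s t => ENNReal.ofReal (K H (s - t))) _ hk (fun s => ‖f.1 s‖ₑ) (fun s => ‖g.1 s‖ₑ)
    hf.enorm hg.enorm (ε := 1) one_ne_zero
  refine lt_of_le_of_lt ?_ (lt_of_le_of_lt h ?_)
  · refine lintegral_mono fun s => lintegral_mono fun t => ?_
    rw [enorm_mul]
    gcongr
    · exact le_self_add
    · exact le_add_self
  · exact ENNReal.add_lt_top.2 ⟨ENNReal.mul_lt_top (by norm_num) f.2.2,
      ENNReal.mul_lt_top (by norm_num) g.2.2⟩

theorem integral_pairMeas (H : ℝ) (f g : AbsH H) :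
    ∫ p, f.1 p.1 * g.1 p.2 ∂pairMeas H = innerH H f g := by
  unfold pairMeas innerH
  rw [integral_withDensity_eq_integral_toReal_smul (by fun_prop)
    (ae_of_all _ fun _ => ENNReal.ofReal_lt_top)]
  refine integral_congr_ae (ae_of_all _ fun p => ?_)
  simp only [ENNReal.toReal_ofReal (K_nonneg _ _), smul_eq_mul]
  ring

/-- The function `g ⊗ g`, `g' ⊗ g'` or `g ⊗ g'`, according to the kind of the pair. -/
def pairFactor {H : ℝ} {k r : ℕ} (g g' : AbsH H) : Fin k ⊕ Fin k ⊕ Fin r → ℝ × ℝ → ℝ :=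
  Sum.elim (fun _ p => g.1 p.1 * g.1 p.2)
    (Sum.elim (fun _ p => g'.1 p.1 * g'.1 p.2) (fun _ p => g.1 p.1 * g'.1 p.2))

theorem prod_leftHalf_mul_prod_rightHalf {H : ℝ} {k r : ℕ} (g g' : AbsH H)
    (w : Fin k ⊕ Fin k ⊕ Fin r → ℝ × ℝ) :
    (∏ i, g.1 (leftHalf w i)) * (∏ i, g'.1 (rightHalf w i)) =
      ∏ x, pairFactor g g' x (w x) := by
  have hflat : ∀ (g : AbsH H) (v : Fin k → ℝ × ℝ),
      ∏ j, g.1 (flatten v j) = ∏ i, (g.1 (v i).1 * g.1 (v i).2) := by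
    intro g v
    rw [← (evenOdd k).prod_comp, Fintype.prod_sum_type, ← Finset.prod_mul_distrib]
    refine Finset.prod_congr rfl fun i _ => ?_
    simp [flatten]
  unfold leftHalf rightHalf
  rw [Fin.prod_univ_add, Fin.prod_univ_add]
  simp only [Fin.append_left, Fin.append_right, hflat, Fintype.prod_sum_type, pairFactor,
    Sum.elim_inl, Sum.elim_inr]
  rw [Finset.prod_mul_distrib (f := fun x : Fin r => g.1 (w (.inr (.inr x))).1)]
  ring

theorem integrable_prod_pairFactor {H : ℝ} (hH' : H < 1) {k r : ℕ} (g g' : AbsH H) :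
    Integrable (fun w => ∏ x, pairFactor (k := k) (r := r) g g' x (w x)) (pairingMeas H k r) := by
  refine Integrable.fintype_prod fun x => ?_
  rcases x with x | x | x
  · exact AbsH.integrable_mul hH' g g
  · exact AbsH.integrable_mul hH' g' g'
  · exact AbsH.integrable_mul hH' g g'

theorem integral_prod_pairFactor {H : ℝ} {k r : ℕ} (g g' : AbsH H) :
    ∫ w, ∏ x, pairFactor (k := k) (r := r) g g' x (w x) ∂pairingMeas H k r =
      innerH H g g ^ k * innerH H g' g' ^ k * innerH H g g' ^ r := by
  unfold pairingMeas
  rw [integral_fintype_prod_eq_prod]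
  simp only [Fintype.prod_sum_type, pairFactor, Sum.elim_inl, Sum.elim_inr, integral_pairMeas,
    Finset.prod_const, Finset.card_univ, Fintype.card_fin]
  ring

@[fun_prop]
theorem measurable_tensorPoly {H : ℝ} (n : ℕ) (c : AbsH H →₀ ℝ) :
    Measurable (tensorPoly n c) := by
  unfold tensorPoly Finsupp.sum
  refine Finset.measurable_sum _ fun g _ => Measurable.const_mul ?_ _
  exact Finset.univ.measurable_prod fun i _ => g.2.1.comp (measurable_pi_apply i)

theorem tensorPoly_mul_eq {H : ℝ} {k r : ℕ} (c : AbsH H →₀ ℝ)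
    (w : Fin k ⊕ Fin k ⊕ Fin r → ℝ × ℝ) :
    tensorPoly (2 * k + r) c (leftHalf w) * tensorPoly (2 * k + r) c (rightHalf w) =
      ∑ g ∈ c.support, ∑ g' ∈ c.support, c g * c g' * ∏ x, pairFactor g g' x (w x) := by
  unfold tensorPoly Finsupp.sum
  rw [Finset.sum_mul_sum]
  refine Finset.sum_congr rfl fun g _ => Finset.sum_congr rfl fun g' _ => ?_
  rw [← prod_leftHalf_mul_prod_rightHalf]
  ring

/-- By Fubini each product of inner products is an integral over pairs, so the double sum is the
integral of $f\otimes f$ over the pairing space; absolute values inside the integral give the trace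
norm. -/
theorem sum_innerH_le_absTraceNormSq {H : ℝ} (hH' : H < 1) (k r : ℕ) (c : AbsH H →₀ ℝ) :
    ENNReal.ofReal (∑ g ∈ c.support, ∑ g' ∈ c.support, c g * c g' *
      (innerH H g g ^ k * innerH H g' g' ^ k * innerH H g g' ^ r)) ≤
      absTraceNormSq H k r (tensorPoly (2 * k + r) c) := by
  have h : ∑ g ∈ c.support, ∑ g' ∈ c.support, c g * c g' *
      (innerH H g g ^ k * innerH H g' g' ^ k * innerH H g g' ^ r) =
      ∫ w, tensorPoly (2 * k + r) c (leftHalf w) * tensorPoly (2 * k + r) c (rightHalf w)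
        ∂pairingMeas H k r := by
    simp_rw [tensorPoly_mul_eq]
    rw [integral_finsetSum _ fun g _ => integrable_finsetSum _ fun g' _ =>
      (integrable_prod_pairFactor hH' g g').const_mul _]
    refine Finset.sum_congr rfl fun g _ => ?_
    rw [integral_finsetSum _ fun g' _ => (integrable_prod_pairFactor hH' g g').const_mul _]
    refine Finset.sum_congr rfl fun g' _ => ?_
    rw [integral_const_mul, integral_prod_pairFactor]
  rw [h, absTraceNormSq_eq _ _ _ _ (measurable_tensorPoly _ c)]
  refine (Real.ofReal_le_enorm _).trans ((enorm_integral_le_lintegral_enorm _).trans ?_)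
  simp_rw [enorm_mul]
  rfl

/-- The squared norm of the `l`-th trace of a function of `m` variables (`0` if `m < 2 l`). -/
def traceNormSq (H : ℝ) (m l : ℕ) (f : (Fin m → ℝ) → ℝ) : ENNReal :=
  if h : 2 * l ≤ m then
    absTraceNormSq H l (m - 2 * l) fun t => f (t ∘ Fin.cast (Nat.add_sub_of_le h).symm)
  else 0

theorem traceNormSq_eq (H : ℝ) {m k r : ℕ} (h : m = 2 * k + r) (f : (Fin m → ℝ) → ℝ) :
    traceNormSq H m k f = absTraceNormSq H k r fun t => f (t ∘ Fin.cast h) := by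
  obtain rfl : r = m - 2 * k := by omega
  unfold traceNormSq
  rw [dif_pos (by omega)]

theorem traceNormSq_self (H : ℝ) (k r : ℕ) (f : (Fin (2 * k + r) → ℝ) → ℝ) :
    traceNormSq H (2 * k + r) k f = absTraceNormSq H k r f := traceNormSq_eq H rfl f

theorem traceNormSq_of_lt (H : ℝ) {m l : ℕ} (h : m < 2 * l) (f : (Fin m → ℝ) → ℝ) :
    traceNormSq H m l f = 0 := dif_neg (by omega)

theorem traceNormSq_add_le {H : ℝ} (hH' : H < 1) (m l : ℕ)
    (f g : (Fin m → ℝ) → ℝ) (hf : Measurable f) (hg : Measurable g) {ε : NNReal}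
    (hε : ε ≠ 0) :
    traceNormSq H m l (fun t => f t + g t) ≤
      (1 + ε) * traceNormSq H m l f + (1 + (ε⁻¹ : NNReal)) * traceNormSq H m l g := by
  rcases lt_or_ge m (2 * l) with h | h
  · rw [traceNormSq_of_lt H h]; exact zero_le
  · obtain ⟨r, rfl⟩ := Nat.exists_eq_add_of_le h
    simp_rw [traceNormSq_self]
    exact absTraceNormSq_add_le hH' l r f g hf hg hε

/-- The weight of the `l`-th trace in the second moment. -/
def wickWeight (m l : ℕ) : ℝ :=
  ((2 * m - 1).doubleFactorial : ℝ) / ((2 * m).choose m : ℝ) * trinomialWeight m l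

theorem wickWeight_nonneg (m l : ℕ) : 0 ≤ wickWeight m l :=
  mul_nonneg (by positivity) (trinomialWeight_nonneg m l)

/-- `wickWeight m l` is the number of perfect matchings of $m+m$ points with $l$ pairs inside each
group, and $(2m-1)!!$ is the number of all matchings. -/
theorem sum_wickWeight (m : ℕ) :
    ∑ l ∈ Finset.range (m + 1), wickWeight m l = ((2 * m - 1).doubleFactorial : ℝ) := by
  unfold wickWeight
  rw [← Finset.mul_sum, sum_trinomialWeight]
  have : ((2 * m).choose m : ℝ) ≠ 0 := by
    exact_mod_cast (Nat.choose_pos (by omega)).ne'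
  field_simp

section Isonormal

variable {Ω : Type*} [MeasurableSpace Ω] {P : Measure Ω} [IsProbabilityMeasure P] {H : ℝ}
  {W : AbsH H → Ω → ℝ}

theorem IsIsonormal.integrable_pow_mul_pow (hW : IsIsonormal P H W) (g g' : AbsH H) (p q : ℕ) :
    Integrable (fun ω => W g ω ^ p * W g' ω ^ q) P :=
  Pinning.integrable_pow_mul_pow (hW.gaussian.hasGaussianLaw_eval g)
    (hW.gaussian.hasGaussianLaw_eval g') p q

theorem IsIsonormal.integral_pow_mul_pow (hW : IsIsonormal P H W) (g g' : AbsH H) (m : ℕ) :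
    ∫ ω, W g ω ^ m * W g' ω ^ m ∂P = ∑ l ∈ Finset.range (m + 1), wickWeight m l *
      (innerH H g g ^ l * innerH H g' g' ^ l * innerH H g g' ^ (m - 2 * l)) := by
  have h := choose_mul_integral_pow_mul_pow (hW.gaussian.hasGaussianLaw_prodMk (s := g) (t := g'))
    (hW.centered g) (hW.centered g') m
  simp only [hW.covariance] at h
  have hc : ((2 * m).choose m : ℝ) ≠ 0 := by
    exact_mod_cast (Nat.choose_pos (by omega)).ne'
  unfold wickWeight
  simp_rw [mul_assoc (_ / _)]
  rw [← Finset.mul_sum, div_mul_eq_mul_div, eq_div_iff hc, mul_comm, h]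

theorem IsIsonormal.memLp_tensorPolyInt (hW : IsIsonormal P H W) (m : ℕ) (c : AbsH H →₀ ℝ) :
    MemLp (tensorPolyInt W m c) 2 P := by
  have h : ∀ g, MemLp (fun ω => W g ω ^ m) 2 P := fun g => by
    rw [memLp_two_iff_integrable_sq ((hW.gaussian.aemeasurable g).pow_const m).aestronglyMeasurable]
    simpa [← sq] using hW.integrable_pow_mul_pow g g m m
  exact memLp_finsetSum c.support fun g _ => (h g).const_mul (c g)

theorem IsIsonormal.integral_tensorPolyInt_sq_le (hW : IsIsonormal P H W) (hH' : H < 1) (m : ℕ)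
    (c : AbsH H →₀ ℝ) :
    ENNReal.ofReal (∫ ω, tensorPolyInt W m c ω ^ 2 ∂P) ≤
      ∑ l ∈ Finset.range (m + 1), ENNReal.ofReal (wickWeight m l) *
        traceNormSq H m l (tensorPoly m c) := by
  have h1 : ∀ ω, tensorPolyInt W m c ω ^ 2 = ∑ g ∈ c.support, ∑ g' ∈ c.support,
      c g * c g' * (W g ω ^ m * W g' ω ^ m) := by
    intro ω
    unfold tensorPolyInt Finsupp.sum
    rw [sq, Finset.sum_mul_sum]
    refine Finset.sum_congr rfl fun g _ => Finset.sum_congr rfl fun g' _ => ?_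
    ring
  have h2 : ∫ ω, tensorPolyInt W m c ω ^ 2 ∂P = ∑ l ∈ Finset.range (m + 1), wickWeight m l *
      ∑ g ∈ c.support, ∑ g' ∈ c.support, c g * c g' *
        (innerH H g g ^ l * innerH H g' g' ^ l * innerH H g g' ^ (m - 2 * l)) := by
    simp_rw [h1]
    rw [integral_finsetSum _ fun g _ => integrable_finsetSum _ fun g' _ =>
      (hW.integrable_pow_mul_pow g g' m m).const_mul _]
    have : ∀ g ∈ c.support, ∫ ω, ∑ g' ∈ c.support, c g * c g' * (W g ω ^ m * W g' ω ^ m) ∂P =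
        ∑ l ∈ Finset.range (m + 1), ∑ g' ∈ c.support, wickWeight m l * (c g * c g' *
        (innerH H g g ^ l * innerH H g' g' ^ l * innerH H g g' ^ (m - 2 * l))) := by
      intro g _
      rw [integral_finsetSum _ fun g' _ => (hW.integrable_pow_mul_pow g g' m m).const_mul _,
        Finset.sum_comm]
      refine Finset.sum_congr rfl fun g' _ => ?_
      rw [integral_const_mul, hW.integral_pow_mul_pow, Finset.mul_sum]
      refine Finset.sum_congr rfl fun l _ => ?_
      ring
    rw [Finset.sum_congr rfl this, Finset.sum_comm]
    refine Finset.sum_congr rfl fun l _ => ?_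
    simp_rw [Finset.mul_sum]
  rw [h2]
  refine (Finset.le_sum_of_subadditive ENNReal.ofReal ENNReal.ofReal_zero.le
    (fun _ _ => ENNReal.ofReal_add_le) _ _).trans (Finset.sum_le_sum fun l _ => ?_)
  rw [ENNReal.ofReal_mul (wickWeight_nonneg m l)]
  -- For $2l>m$ the weight is zero, so the truncated exponent `m - 2 * l` is harmless.
  rcases lt_or_ge m (2 * l) with h | h
  · have : wickWeight m l = 0 := by
      unfold wickWeight trinomialWeight
      rw [if_neg (by omega), mul_zero]
    simp [this]
  · gcongr
    obtain ⟨r, rfl⟩ := Nat.exists_eq_add_of_le h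
    rw [traceNormSq_self, Nat.add_sub_cancel_left]
    exact sum_innerH_le_absTraceNormSq hH' l r c

end Isonormal

/-! ### Multiple Stratonovich integrals: existence and second moments -/

/-- The bound for the second moment of the Stratonovich integral of `f` given by Wick's
formula. -/
def wickNormSq (H : ℝ) (m : ℕ) (f : (Fin m → ℝ) → ℝ) : ENNReal :=
  ∑ l ∈ Finset.range (m + 1), ENNReal.ofReal (wickWeight m l) * traceNormSq H m l f

theorem wickNormSq_add_le {H : ℝ} (hH' : H < 1) (m : ℕ) (f g : (Fin m → ℝ) → ℝ)
    (hf : Measurable f) (hg : Measurable g) {ε : NNReal} (hε : ε ≠ 0) :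
    wickNormSq H m (fun t => f t + g t) ≤
      (1 + ε) * wickNormSq H m f + (1 + (ε⁻¹ : NNReal)) * wickNormSq H m g := by
  unfold wickNormSq
  rw [Finset.mul_sum, Finset.mul_sum, ← Finset.sum_add_distrib]
  refine Finset.sum_le_sum fun l _ => ?_
  rw [mul_left_comm (1 + (ε : ENNReal)), mul_left_comm (1 + ((ε⁻¹ : NNReal) : ENNReal)), ← mul_add]
  gcongr
  exact traceNormSq_add_le hH' m l f g hf hg hε

theorem traceNormSq_neg (H : ℝ) (m l : ℕ) (f : (Fin m → ℝ) → ℝ) :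
    traceNormSq H m l (fun t => -f t) = traceNormSq H m l f := by
  unfold traceNormSq absTraceNormSq absTrace traceIntegrand
  simp only [neg_mul, enorm_neg]

theorem wickNormSq_neg (H : ℝ) (m : ℕ) (f : (Fin m → ℝ) → ℝ) :
    wickNormSq H m (fun t => -f t) = wickNormSq H m f := by
  unfold wickNormSq
  simp_rw [traceNormSq_neg]

theorem tendsto_wickNormSq {H : ℝ} {m : ℕ} {f : ℕ → (Fin m → ℝ) → ℝ}
    (h : ∀ l, Tendsto (fun j => traceNormSq H m l (f j)) atTop (𝓝 0)) :
    Tendsto (fun j => wickNormSq H m (f j)) atTop (𝓝 0) := by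
  unfold wickNormSq
  rw [← Finset.sum_const_zero (s := Finset.range (m + 1)) (M := ENNReal)]
  refine tendsto_finsetSum _ fun l _ => ?_
  simpa using ENNReal.Tendsto.const_mul (h l) (.inr (ENNReal.ofReal_ne_top (r := wickWeight m l)))

theorem eLpNorm_two_sq {Ω : Type*} [MeasurableSpace Ω] {P : Measure Ω} {X : Ω → ℝ}
    (hX : MemLp X 2 P) : eLpNorm X 2 P ^ 2 = ENNReal.ofReal (∫ ω, X ω ^ 2 ∂P) := by
  have h := eLpNorm_nnreal_pow_eq_lintegral (μ := P) (f := X) (p := 2) two_ne_zero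
  simp only [NNReal.coe_ofNat, ENNReal.coe_ofNat, ENNReal.rpow_ofNat] at h
  rw [h, ofReal_integral_eq_lintegral_ofReal hX.integrable_sq (ae_of_all _ fun _ => sq_nonneg _)]
  refine lintegral_congr fun ω => ?_
  rw [← enorm_pow, Real.enorm_eq_ofReal (sq_nonneg _)]

theorem tensorPoly_sub {H : ℝ} (n : ℕ) (c c' : AbsH H →₀ ℝ) (t : Fin n → ℝ) :
    tensorPoly n (c - c') t = tensorPoly n c t - tensorPoly n c' t := by
  unfold tensorPoly
  exact Finsupp.sum_sub_index fun g a b => sub_mul _ _ _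

theorem tensorPolyInt_sub {Ω : Type*} {H : ℝ} (W : AbsH H → Ω → ℝ) (n : ℕ) (c c' : AbsH H →₀ ℝ) (ω : Ω) :
    tensorPolyInt W n (c - c') ω = tensorPolyInt W n c ω - tensorPolyInt W n c' ω := by
  unfold tensorPolyInt
  exact Finsupp.sum_sub_index fun g a b => sub_mul _ _ _

section Isonormal

variable {Ω : Type*} [MeasurableSpace Ω] {P : Measure Ω} [IsProbabilityMeasure P] {H : ℝ}
  {W : AbsH H → Ω → ℝ}

theorem IsIsonormal.eLpNorm_tensorPolyInt_le (hW : IsIsonormal P H W) (hH' : H < 1) (m : ℕ)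
    (c : AbsH H →₀ ℝ) :
    eLpNorm (tensorPolyInt W m c) 2 P ≤ wickNormSq H m (tensorPoly m c) ^ (2 : ℝ)⁻¹ := by
  rw [ENNReal.le_rpow_inv_iff two_pos, ENNReal.rpow_ofNat,
    eLpNorm_two_sq (hW.memLp_tensorPolyInt m c)]
  exact hW.integral_tensorPolyInt_sq_le hH' m c

/-- The bound for tensor polynomials passes to the limit: the weighted triangle inequality costs a
factor $1+\varepsilon$ on $f$ and a multiple of the vanishing approximation error. Letting
$j\to\infty$ and then $\varepsilon\to0$ leaves the constant one. -/
theorem IsStratonovichIntegral.integral_sq_le (hW : IsIsonormal P H W) (hH' : H < 1) {m : ℕ}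
    {f : (Fin m → ℝ) → ℝ} (hf : Measurable f) {X : Ω → ℝ}
    (hX : IsStratonovichIntegral P W m f X) :
    ENNReal.ofReal (∫ ω, X ω ^ 2 ∂P) ≤ wickNormSq H m f := by
  obtain ⟨-, hX2, c, hc, hcX⟩ := hX
  rw [← eLpNorm_two_sq hX2]
  have hconv : Tendsto (fun j => wickNormSq H m fun t => tensorPoly m (c j) t - f t) atTop
      (𝓝 0) := by
    refine tendsto_wickNormSq fun l => ?_
    rcases lt_or_ge m (2 * l) with h | h
    · simp_rw [traceNormSq_of_lt H h]
      exact tendsto_const_nhds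
    · obtain ⟨r, hr⟩ := Nat.exists_eq_add_of_le h
      simp_rw [traceNormSq_eq H hr]
      exact hc l r hr
  have key : ∀ ε : NNReal, ε ≠ 0 → eLpNorm X 2 P ^ 2 ≤ (1 + ε) * wickNormSq H m f := by
    intro ε hε
    rcases eq_or_ne (wickNormSq H m f) ⊤ with htop | htop
    · rw [htop, ENNReal.mul_top (by simp)]; exact le_top
    rw [← ENNReal.rpow_ofNat, ← ENNReal.le_rpow_inv_iff two_pos]
    have hb : ∀ j, eLpNorm X 2 P ≤
        ((1 + ε) * wickNormSq H m f + (1 + (ε⁻¹ : NNReal)) *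
          wickNormSq H m fun t => tensorPoly m (c j) t - f t) ^ (2 : ℝ)⁻¹ +
        eLpNorm (fun ω => tensorPolyInt W m (c j) ω - X ω) 2 P := by
      intro j
      have h1 := eLpNorm_sub_le (hW.memLp_tensorPolyInt m (c j)).aestronglyMeasurable
        ((hW.memLp_tensorPolyInt m (c j)).aestronglyMeasurable.sub hX2.aestronglyMeasurable)
        (μ := P) (p := 2) one_le_two
      rw [sub_sub_cancel] at h1
      refine h1.trans (add_le_add ((hW.eLpNorm_tensorPolyInt_le hH' m (c j)).trans ?_) le_rfl)
      gcongr
      have h2 := wickNormSq_add_le hH' m f (fun t => tensorPoly m (c j) t - f t) hf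
        ((measurable_tensorPoly m (c j)).sub hf) hε
      simpa using h2
    have hlim : Tendsto (fun j => ((1 + ε) * wickNormSq H m f + (1 + (ε⁻¹ : NNReal)) *
          wickNormSq H m fun t => tensorPoly m (c j) t - f t) ^ (2 : ℝ)⁻¹ +
        eLpNorm (fun ω => tensorPolyInt W m (c j) ω - X ω) 2 P) atTop
        (𝓝 (((1 + ε) * wickNormSq H m f + (1 + (ε⁻¹ : NNReal)) * 0) ^ (2 : ℝ)⁻¹ + 0)) := by
      refine Tendsto.add ?_ hcX
      refine (ENNReal.continuous_rpow_const.tendsto _).comp ?_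
      refine Tendsto.add tendsto_const_nhds ?_
      exact ENNReal.Tendsto.const_mul hconv (.inr (by simp))
    have := ge_of_tendsto' hlim hb
    simpa using this
  have hlim : Tendsto (fun n : ℕ => (1 + ((((n : NNReal) + 1)⁻¹ : NNReal) : ENNReal)) *
      wickNormSq H m f) atTop (𝓝 ((1 + ((0 : NNReal) : ENNReal)) * wickNormSq H m f)) := by
    refine ENNReal.Tendsto.mul_const ?_ (.inl (by simp))
    refine tendsto_const_nhds.add (ENNReal.tendsto_coe.2 ?_)
    have h := tendsto_one_div_add_atTop_nhds_zero_nat (𝕜 := ℝ)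
    rw [← NNReal.tendsto_coe]
    simpa using h
  have := ge_of_tendsto' hlim fun n => key _ (by positivity)
  simpa using this

/-- An approximation by tensor polynomials in all trace norms gives a Stratonovich integral. -/
theorem IsIsonormal.exists_isStratonovichIntegral (hW : IsIsonormal P H W) (hH' : H < 1) {m : ℕ}
    {f : (Fin m → ℝ) → ℝ} (hf : Measurable f) (c : ℕ → (AbsH H →₀ ℝ))
    (hc : ∀ l, Tendsto (fun j => traceNormSq H m l fun t => tensorPoly m (c j) t - f t) atTop
      (𝓝 0)) :
    ∃ X, IsStratonovichIntegral P W m f X := by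
  have hconv := tendsto_wickNormSq hc
  -- The difference of two approximations is compared through $f$. Only convergence to zero matters
  -- here, so $\varepsilon=1$ suffices.
  have hb : ∀ i j, eLpNorm (tensorPolyInt W m (c i) - tensorPolyInt W m (c j)) 2 P ≤
      ((1 + (1 : NNReal)) * wickNormSq H m (fun t => tensorPoly m (c i) t - f t) +
        (1 + ((1 : NNReal)⁻¹ : NNReal)) * wickNormSq H m (fun t => tensorPoly m (c j) t - f t))
          ^ (2 : ℝ)⁻¹ := by
    intro i j
    have h1 := hW.eLpNorm_tensorPolyInt_le hH' m (c i - c j)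
    have e1 : tensorPolyInt W m (c i - c j) =
        tensorPolyInt W m (c i) - tensorPolyInt W m (c j) := by
      ext ω; exact tensorPolyInt_sub W m _ _ ω
    rw [e1] at h1
    refine h1.trans ?_
    gcongr
    have h2 := wickNormSq_add_le hH' m (fun t => tensorPoly m (c i) t - f t)
      (fun t => -(tensorPoly m (c j) t - f t)) ((measurable_tensorPoly m (c i)).sub hf)
        ((measurable_tensorPoly m (c j)).sub hf).neg (ε := 1) one_ne_zero
    rw [wickNormSq_neg] at h2
    refine le_trans (le_of_eq ?_) h2
    congr 1
    ext t
    rw [tensorPoly_sub]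
    ring
  have hlim : Tendsto (fun p : ℕ × ℕ =>
      ((1 + (1 : NNReal)) * wickNormSq H m (fun t => tensorPoly m (c p.1) t - f t) +
        (1 + ((1 : NNReal)⁻¹ : NNReal)) * wickNormSq H m (fun t => tensorPoly m (c p.2) t - f t))
          ^ (2 : ℝ)⁻¹) atTop (𝓝 (((1 + (1 : NNReal)) * 0 +
            (1 + ((1 : NNReal)⁻¹ : NNReal)) * 0) ^ (2 : ℝ)⁻¹)) := by
    refine (ENNReal.continuous_rpow_const.tendsto _).comp ?_
    rw [← prod_atTop_atTop_eq]
    refine Tendsto.add ?_ ?_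
    · exact ENNReal.Tendsto.const_mul (hconv.comp tendsto_fst) (.inr (by simp))
    · exact ENNReal.Tendsto.const_mul (hconv.comp tendsto_snd) (.inr (by simp))
  have hL := fun j => hW.memLp_tensorPolyInt m (c j)
  have hcauchy : CauchySeq fun j => (hL j).toLp := by
    rw [Lp.cauchySeq_Lp_iff_cauchySeq_eLpNorm]
    simp only [mul_zero, add_zero, ENNReal.zero_rpow_of_pos (inv_pos.2 (two_pos (α := ℝ)))] at hlim
    refine tendsto_of_tendsto_of_tendsto_of_le_of_le tendsto_const_nhds
      hlim (fun _ => zero_le) fun p => ?_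
    refine le_trans (le_of_eq (eLpNorm_congr_ae ?_)) (hb p.1 p.2)
    exact (hL p.1).coeFn_toLp.sub (hL p.2).coeFn_toLp
  obtain ⟨X, hX⟩ := cauchySeq_tendsto_of_complete hcauchy
  refine ⟨X, hf.aestronglyMeasurable, Lp.memLp X, c, fun k r h => ?_, ?_⟩
  · have := hc k
    simp_rw [traceNormSq_eq H h] at this
    exact this
  · rw [Lp.tendsto_Lp_iff_tendsto_eLpNorm'] at hX
    refine hX.congr fun j => eLpNorm_congr_ae ?_
    exact (hL j).coeFn_toLp.sub (EventuallyEq.refl _ _)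

end Isonormal

/-! ### Approximation by tensor polynomials -/

/-- A bounded measurable function as an element of `|𝓗|`. -/
def AbsH.ofBounded {H : ℝ} (hH : 1 / 2 < H) (g : ℝ → ℝ) (hg : Measurable g) (M : ℝ)
    (hM : ∀ x, |g x| ≤ M) : AbsH H :=
  ⟨g, hg, by
    have := isFiniteMeasure_pairMeas hH
    have hm : Measurable fun p : ℝ × ℝ => ‖g p.1‖ₑ * ‖g p.2‖ₑ :=
      (hg.comp measurable_fst).enorm.mul (hg.comp measurable_snd).enorm
    have h := lintegral_pairMeas H (fun p => ‖g p.1‖ₑ * ‖g p.2‖ₑ) hm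
    simp only at h
    rw [← h]
    refine lt_of_le_of_lt (lintegral_mono (g := fun _ => ENNReal.ofReal M * ENNReal.ofReal M)
      fun p => ?_) ?_
    · have hb : ∀ x, ‖g x‖ₑ ≤ ENNReal.ofReal M := fun x => by
        rw [← ofReal_norm]
        exact ENNReal.ofReal_le_ofReal (hM x)
      exact mul_le_mul' (hb _) (hb _)
    · rw [lintegral_const]
      exact ENNReal.mul_lt_top (ENNReal.mul_lt_top ENNReal.ofReal_lt_top ENNReal.ofReal_lt_top)
        (measure_lt_top _ _)⟩

/-- Functions of the form `∑ c_g g ^ {⊗ m}`. -/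
def IsTensorPoly (H : ℝ) (m : ℕ) (f : (Fin m → ℝ) → ℝ) : Prop :=
  ∃ c : AbsH H →₀ ℝ, ∀ t, tensorPoly m c t = f t

theorem IsTensorPoly.zero (H : ℝ) (m : ℕ) : IsTensorPoly H m fun _ => 0 :=
  ⟨0, fun _ => Finsupp.sum_zero_index⟩

theorem IsTensorPoly.add {H : ℝ} {m : ℕ} {f g : (Fin m → ℝ) → ℝ} (hf : IsTensorPoly H m f)
    (hg : IsTensorPoly H m g) : IsTensorPoly H m fun t => f t + g t := by
  obtain ⟨c, hc⟩ := hf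
  obtain ⟨d, hd⟩ := hg
  refine ⟨c + d, fun t => ?_⟩
  simp only [← hc, ← hd]
  exact Finsupp.sum_add_index' (fun g => zero_mul _) fun g a b => add_mul _ _ _

theorem IsTensorPoly.sum {H : ℝ} {m : ℕ} {ι : Type*} (s : Finset ι) {f : ι → (Fin m → ℝ) → ℝ}
    (hf : ∀ i ∈ s, IsTensorPoly H m (f i)) : IsTensorPoly H m fun t => ∑ i ∈ s, f i t := by
  classical
  induction s using Finset.induction_on with
  | empty => simpa using IsTensorPoly.zero H m
  | insert i s hi ih =>
    simp_rw [Finset.sum_insert hi]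
    exact (hf i (Finset.mem_insert_self i s)).add
      (ih fun j hj => hf j (Finset.mem_insert_of_mem hj))

theorem IsTensorPoly.const_mul {H : ℝ} {m : ℕ} {f : (Fin m → ℝ) → ℝ} (a : ℝ)
    (hf : IsTensorPoly H m f) : IsTensorPoly H m fun t => a * f t := by
  obtain ⟨c, hc⟩ := hf
  refine ⟨a • c, fun t => ?_⟩
  simp only [← hc]
  unfold tensorPoly
  rw [Finsupp.sum_smul_index fun g => zero_mul _, Finsupp.mul_sum]
  refine Finsupp.sum_congr fun g _ => ?_
  ring

theorem IsTensorPoly.pow {H : ℝ} (m : ℕ) (g : AbsH H) :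
    IsTensorPoly H m fun t => ∏ i, g.1 (t i) :=
  ⟨Finsupp.single g 1, fun t => by simp [tensorPoly]⟩

/-- Polarization: a symmetrized product is a combination of powers of sums. -/
theorem sum_perm_prod_eq {m : ℕ} (a : Fin m → Fin m → ℝ) :
    ∑ σ : Equiv.Perm (Fin m), ∏ i, a (σ i) i =
      ∑ S : Finset (Fin m), (-1) ^ S.card * ∏ i, ∑ j ∈ Sᶜ, a j i := by
  have h1 : ∀ S : Finset (Fin m), ∏ i, ∑ j ∈ Sᶜ, a j i =
      ∑ h : Fin m → Fin m, if S ⊆ (Finset.univ.image h)ᶜ then ∏ i, a (h i) i else 0 := by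
    intro S
    rw [Finset.prod_univ_sum, ← Finset.sum_filter]
    refine Finset.sum_congr ?_ fun _ _ => rfl
    ext h
    simp only [Fintype.mem_piFinset, Finset.mem_compl, Finset.mem_filter, Finset.mem_univ,
      true_and, Finset.subset_iff, Finset.mem_image, not_exists]
    exact ⟨fun hh x hx i hi => hh i (hi ▸ hx), fun hh i hi => hh hi i rfl⟩
  simp_rw [h1, Finset.mul_sum]
  rw [Finset.sum_comm]
  -- Inclusion-exclusion: the alternating sum over the subsets of the complement of the image of `h`
  -- vanishes unless that complement is empty, that is, unless `h` is a permutation.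
  have h2 : ∀ h : Fin m → Fin m, ∑ S : Finset (Fin m), (-1 : ℝ) ^ S.card *
      (if S ⊆ (Finset.univ.image h)ᶜ then ∏ i, a (h i) i else 0) =
      if Function.Bijective h then ∏ i, a (h i) i else 0 := by
    intro h
    have e : ∀ S : Finset (Fin m), (-1 : ℝ) ^ S.card *
        (if S ⊆ (Finset.univ.image h)ᶜ then ∏ i, a (h i) i else 0) =
        if S ⊆ (Finset.univ.image h)ᶜ then (-1 : ℝ) ^ S.card * ∏ i, a (h i) i else 0 :=
      fun S => by split_ifs <;> simp
    simp_rw [e]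
    rw [← Finset.sum_filter, ← Finset.sum_mul]
    have hps : (Finset.univ.filter fun S => S ⊆ (Finset.univ.image h)ᶜ) =
        ((Finset.univ.image h)ᶜ).powerset := by ext; simp
    have hcard := Finset.sum_powerset_neg_one_pow_card (x := (Finset.univ.image h)ᶜ)
    have hcard' : ∑ S ∈ ((Finset.univ.image h)ᶜ).powerset, (-1 : ℝ) ^ S.card =
        if (Finset.univ.image h)ᶜ = ∅ then 1 else 0 := by
      exact_mod_cast congrArg (Int.cast : ℤ → ℝ) hcard
    rw [hps, hcard']
    have hiff : (Finset.univ.image h)ᶜ = ∅ ↔ Function.Bijective h := by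
      rw [Finset.compl_eq_empty_iff, ← Finite.surjective_iff_bijective]
      simp [Finset.eq_univ_iff_forall, Function.Surjective]
    simp only [hiff]
    split_ifs <;> simp
  simp_rw [h2]
  rw [← Finset.sum_filter]
  refine Finset.sum_bij (fun σ _ => ⇑σ) (fun σ _ =>
    Finset.mem_filter.2 ⟨Finset.mem_univ _, σ.bijective⟩)
    (fun σ _ τ _ hστ => Equiv.ext (congrFun hστ)) (fun h hh => ?_) fun σ _ => rfl
  simp only [Finset.mem_filter, Finset.mem_univ, true_and] at hh
  exact ⟨Equiv.ofBijective h hh, Finset.mem_univ _, rfl⟩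

theorem isTensorPoly_sum_perm {H : ℝ} (hH : 1 / 2 < H) {m : ℕ} (u : Fin m → ℝ → ℝ)
    (hu : ∀ j, Measurable (u j)) (hb : ∀ j x, |u j x| ≤ 1) :
    IsTensorPoly H m fun t => ∑ σ : Equiv.Perm (Fin m), ∏ i, u i (t (σ i)) := by
  have h1 : ∀ t : Fin m → ℝ, ∑ σ : Equiv.Perm (Fin m), ∏ i, u i (t (σ i)) =
      ∑ S : Finset (Fin m), (-1) ^ S.card * ∏ i, ∑ j ∈ Sᶜ, u j (t i) := by
    intro t
    rw [← sum_perm_prod_eq fun j i => u j (t i), ← Equiv.sum_comp (Equiv.inv (Equiv.Perm (Fin m)))]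
    refine Finset.sum_congr rfl fun σ _ => ?_
    rw [← Equiv.prod_comp σ]
    simp
  simp_rw [h1]
  refine IsTensorPoly.sum _ fun S _ => IsTensorPoly.const_mul _ ?_
  exact IsTensorPoly.pow m (AbsH.ofBounded hH (fun x => ∑ j ∈ Sᶜ, u j x)
    (Finset.measurable_sum _ fun j _ => hu j) (∑ j ∈ Sᶜ, 1) fun x =>
      (Finset.abs_sum_le_sum_abs _ _).trans (Finset.sum_le_sum fun j _ => hb j x))

/-- The average of a function over all permutations of its variables. -/
def symmetrize {m : ℕ} (f : (Fin m → ℝ) → ℝ) (t : Fin m → ℝ) : ℝ :=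
  ((m.factorial : ℝ))⁻¹ * ∑ σ : Equiv.Perm (Fin m), f (t ∘ σ)

theorem symmetrize_of_symmetric {m : ℕ} (f : (Fin m → ℝ) → ℝ)
    (hf : ∀ t (σ : Equiv.Perm (Fin m)), f (t ∘ σ) = f t) (t : Fin m → ℝ) :
    symmetrize f t = f t := by
  unfold symmetrize
  simp only [hf, Finset.sum_const, Finset.card_univ, Fintype.card_perm, Fintype.card_fin,
    nsmul_eq_mul]
  have : (m.factorial : ℝ) ≠ 0 := by positivity
  field_simp

/-- Step function with the values of `h` at the points of a grid. -/
def gridStep {m : ℕ} (h : (Fin m → ℝ) → ℝ) (N : ℕ) (t : Fin m → ℝ) : ℝ :=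
  ∑ e : Fin m → Fin (N + 1), h (fun i => (e i : ℝ) / N) *
    ∏ i, (Set.Ico ((e i : ℝ) / N) (((e i : ℝ) + 1) / N)).indicator 1 (t i)

theorem isTensorPoly_symmetrize_gridStep {H : ℝ} (hH : 1 / 2 < H) {m : ℕ}
    (h : (Fin m → ℝ) → ℝ) (N : ℕ) : IsTensorPoly H m (symmetrize (gridStep h N)) := by
  have : symmetrize (gridStep h N) = fun t => ((m.factorial : ℝ))⁻¹ *
      ∑ e : Fin m → Fin (N + 1), h (fun i => (e i : ℝ) / N) *
        ∑ σ : Equiv.Perm (Fin m),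
          ∏ i, (Set.Ico ((e i : ℝ) / N) (((e i : ℝ) + 1) / N)).indicator 1 (t (σ i)) := by
    ext t
    unfold symmetrize gridStep
    rw [Finset.sum_comm]
    simp_rw [Finset.mul_sum]
    rfl
  rw [this]
  refine IsTensorPoly.const_mul _ (IsTensorPoly.sum _ fun e _ => IsTensorPoly.const_mul _ ?_)
  refine isTensorPoly_sum_perm hH
    (fun i => (Set.Ico ((e i : ℝ) / N) (((e i : ℝ) + 1) / N)).indicator 1)
    (fun i => measurable_one.indicator measurableSet_Ico) fun i x => ?_
  by_cases hx : x ∈ Set.Ico ((e i : ℝ) / N) (((e i : ℝ) + 1) / N)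
  · rw [Set.indicator_of_mem hx]; simp
  · rw [Set.indicator_of_notMem hx]; simp

theorem measurable_gridStep {m : ℕ} (h : (Fin m → ℝ) → ℝ) (N : ℕ) :
    Measurable (gridStep h N) := by
  unfold gridStep
  refine Finset.measurable_sum _ fun e _ => Measurable.const_mul ?_ _
  exact Finset.univ.measurable_prod fun i _ =>
    (measurable_one.indicator measurableSet_Ico).comp (measurable_pi_apply i)

theorem gridStep_apply {m : ℕ} (h : (Fin m → ℝ) → ℝ) {N : ℕ} (hN : 0 < N) (t : Fin m → ℝ)
    (ht : ∀ i, t i ∈ Set.Icc (0:ℝ) 1) :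
    gridStep h N t = h fun i => (⌊t i * N⌋₊ : ℝ) / N := by
  have hN' : (0:ℝ) < N := by exact_mod_cast hN
  -- At $t_i=1$ the floor equals $N$; this is why the half-open grid has $N+1$ cells in each
  -- direction.
  have hle : ∀ i, ⌊t i * N⌋₊ < N + 1 := fun i => by
    rw [Nat.lt_succ_iff]
    refine Nat.floor_le_of_le ?_
    nlinarith [(ht i).2]
  have hmem : ∀ i (a : ℕ), t i ∈ Set.Ico ((a : ℝ) / N) (((a : ℝ) + 1) / N) ↔ a = ⌊t i * N⌋₊ := by
    intro i a
    rw [Set.mem_Ico, div_le_iff₀ hN', lt_div_iff₀ hN', eq_comm,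
      Nat.floor_eq_iff (mul_nonneg (ht i).1 hN'.le)]
  unfold gridStep
  rw [Finset.sum_eq_single fun i => ⟨⌊t i * N⌋₊, hle i⟩]
  · have : ∀ i, (Set.Ico ((⌊t i * N⌋₊ : ℝ) / N) (((⌊t i * N⌋₊ : ℝ) + 1) / N)).indicator
        (1 : ℝ → ℝ) (t i) = 1 := fun i => by
      rw [Set.indicator_of_mem ((hmem i _).2 rfl), Pi.one_apply]
    simp only [this, Finset.prod_const_one, mul_one]
  · intro e _ he
    obtain ⟨i, hi⟩ := Function.ne_iff.1 he
    rw [Finset.prod_eq_zero (Finset.mem_univ i), mul_zero]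
    refine Set.indicator_of_notMem (fun hx => hi ?_) _
    exact Fin.ext ((hmem i _).1 hx)
  · exact fun hh => absurd (Finset.mem_univ _) hh

theorem tendsto_gridStep {m : ℕ} {h : (Fin m → ℝ) → ℝ} (hc : Continuous h) (t : Fin m → ℝ)
    (ht : ∀ i, t i ∈ Set.Icc (0:ℝ) 1) :
    Tendsto (fun N => gridStep h N t) atTop (𝓝 (h t)) := by
  have h1 : Tendsto (fun N : ℕ => h fun i => (⌊t i * N⌋₊ : ℝ) / N) atTop (𝓝 (h t)) := by
    refine (hc.tendsto t).comp (tendsto_pi_nhds.2 fun i => ?_)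
    exact (tendsto_nat_floor_mul_div_atTop (ht i).1).comp tendsto_natCast_atTop_atTop
  refine h1.congr' ?_
  filter_upwards [eventually_gt_atTop 0] with N hN
  rw [gridStep_apply h hN t ht]

/-! ### Convergence in the trace norms -/

/-- Dominated convergence on the pairing space, with the integrand of $G$ as the dominating
function. -/
theorem tendsto_traceNormSq_zero (H : ℝ) {m : ℕ} (l : ℕ) {f : ℕ → (Fin m → ℝ) → ℝ}
    (hf : ∀ j, Measurable (f j)) {G : (Fin m → ℝ) → ℝ} (hG : Measurable G)
    (hGfin : traceNormSq H m l G ≠ ⊤) (hb : ∀ j, ∀ᵐ t ∂cube m, |f j t| ≤ |G t|)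
    (hlim : ∀ᵐ t ∂cube m, Tendsto (fun j => f j t) atTop (𝓝 0)) :
    Tendsto (fun j => traceNormSq H m l (f j)) atTop (𝓝 0) := by
  rcases lt_or_ge m (2 * l) with h | h
  · simp_rw [traceNormSq_of_lt H h]
    exact tendsto_const_nhds
  obtain ⟨r, rfl⟩ := Nat.exists_eq_add_of_le h
  rw [traceNormSq_self, absTraceNormSq_eq _ _ _ _ hG] at hGfin
  simp_rw [traceNormSq_self, absTraceNormSq_eq _ _ _ _ (hf _)]
  have h0 : ∫⁻ _w, (0 : ENNReal) * 0 ∂pairingMeas H l r = 0 := by simp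
  rw [← h0]
  have hle : ∀ {x y : ℝ}, |x| ≤ |y| → ‖x‖ₑ ≤ ‖y‖ₑ := fun {x y} hxy => by
    rw [← ofReal_norm, ← ofReal_norm]
    exact ENNReal.ofReal_le_ofReal hxy
  refine tendsto_lintegral_of_dominated_convergence _ (fun j => ?_) (fun j => ?_) hGfin ?_
  · exact ((hf j).comp measurable_leftHalf).enorm.mul ((hf j).comp measurable_rightHalf).enorm
  · filter_upwards [(quasiMeasurePreserving_leftHalf H l r).ae (hb j),
      (quasiMeasurePreserving_rightHalf H l r).ae (hb j)] with w h1 h2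
    exact mul_le_mul' (hle h1) (hle h2)
  · filter_upwards [(quasiMeasurePreserving_leftHalf H l r).ae hlim,
      (quasiMeasurePreserving_rightHalf H l r).ae hlim] with w h1 h2
    have e1 := (continuous_enorm.tendsto (0:ℝ)).comp h1
    have e2 := (continuous_enorm.tendsto (0:ℝ)).comp h2
    rw [enorm_zero] at e1 e2
    exact ENNReal.Tendsto.mul e1 (.inr ENNReal.zero_ne_top) e2 (.inr ENNReal.zero_ne_top)

theorem traceNormSq_const_ne_top {H : ℝ} (hH : 1 / 2 < H) (m l : ℕ) (M : ℝ) :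
    traceNormSq H m l (fun _ => M) ≠ ⊤ := by
  rcases lt_or_ge m (2 * l) with h | h
  · rw [traceNormSq_of_lt H h]; exact ENNReal.zero_ne_top
  obtain ⟨r, rfl⟩ := Nat.exists_eq_add_of_le h
  rw [traceNormSq_self, absTraceNormSq_eq _ _ _ _ measurable_const, lintegral_const]
  have := isFiniteMeasure_pairMeas hH
  unfold pairingMeas
  exact ENNReal.mul_ne_top (ENNReal.mul_ne_top enorm_ne_top enorm_ne_top) (measure_ne_top _ _)

/-- Truncation of a real number at level `M`. -/
def truncate (M x : ℝ) : ℝ := max (-M) (min x M)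

theorem abs_truncate_le {M : ℝ} (hM : 0 ≤ M) (x : ℝ) : |truncate M x| ≤ M := by
  unfold truncate
  rw [abs_le]
  exact ⟨le_max_left _ _, max_le (by linarith) (min_le_right _ _)⟩

theorem truncate_eq_self {M x : ℝ} (hx : |x| ≤ M) : truncate M x = x := by
  unfold truncate
  rw [abs_le] at hx
  rw [min_eq_left hx.2, max_eq_right hx.1]

theorem abs_sub_truncate_le {M x : ℝ} (hx : |x| ≤ M) (y : ℝ) :
    |x - truncate M y| ≤ |x - y| := by
  have h1 := abs_max_sub_max_le_abs (min x M) (min y M) (-M)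
  have h2 := abs_min_sub_min_le_max x M y M
  rw [sub_self, abs_zero, max_eq_left (abs_nonneg _)] at h2
  nth_rewrite 1 [← truncate_eq_self hx]
  unfold truncate
  rw [max_comm (-M), max_comm (-M)]
  exact h1.trans h2

theorem abs_sub_truncate_le_abs {M : ℝ} (hM : 0 ≤ M) (x : ℝ) : |x - truncate M x| ≤ |x| := by
  unfold truncate
  rcases le_total x M with h1 | h1
  · rw [min_eq_left h1]
    rcases le_total (-M) x with h2 | h2
    · rw [max_eq_right h2, sub_self, abs_zero]; exact abs_nonneg _
    · rw [max_eq_left h2, abs_of_nonpos (by linarith), abs_of_nonpos (by linarith)]; linarith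
  · rw [min_eq_right h1, max_eq_right (by linarith), abs_of_nonneg (by linarith),
      abs_of_nonneg (by linarith)]; linarith

theorem measurable_truncate (M : ℝ) : Measurable (truncate M) := by
  unfold truncate; fun_prop

theorem continuous_truncate (M : ℝ) : Continuous (truncate M) := by
  unfold truncate; fun_prop

/-- A bounded function is the limit in `L¹` of grid step functions with the same bound. -/
theorem exists_gridStep_eLpNorm_le {m : ℕ} {f : (Fin m → ℝ) → ℝ} (hf : Measurable f) {M : ℝ}
    (hM : ∀ t, |f t| ≤ M) {ε : ENNReal} (hε : ε ≠ 0) :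
    ∃ (h : (Fin m → ℝ) → ℝ) (N : ℕ), (∀ᵐ t ∂cube m, |gridStep h N t| ≤ M) ∧
      eLpNorm (gridStep h N - f) 1 (cube m) ≤ ε := by
  have hM0 : 0 ≤ M := (abs_nonneg _).trans (hM 0)
  have hfL : MemLp f 1 (cube m) :=
    MemLp.of_bound hf.aestronglyMeasurable M (ae_of_all _ hM)
  have hε2 : ε / 2 ≠ 0 := (ENNReal.half_pos hε).ne'
  obtain ⟨g, hg, -⟩ := hfL.exists_boundedContinuous_eLpNorm_sub_le ENNReal.one_ne_top hε2
  -- Truncating the continuous approximation restores the bound `M` without increasing its distance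
  -- to `f`.
  let h : (Fin m → ℝ) → ℝ := fun t => truncate M (g t)
  have hc : Continuous h := (continuous_truncate M).comp g.continuous
  have hfh : eLpNorm (h - f) 1 (cube m) ≤ ε / 2 := by
    refine le_trans (eLpNorm_mono fun t => ?_) hg
    simp only [Pi.sub_apply, Real.norm_eq_abs]
    rw [abs_sub_comm]
    exact abs_sub_truncate_le (hM t) _
  -- The shift to `N + 1` avoids the degenerate grid at zero, whose cells would have endpoints
  -- divided by zero.
  have hstep : ∀ N, ∀ᵐ t ∂cube m, |gridStep h (N + 1) t| ≤ M := fun N => by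
    filter_upwards [ae_mem_cube (ι := Fin m)] with t ht
    rw [gridStep_apply h N.succ_pos t ht]
    exact abs_truncate_le hM0 _
  have hlim : Tendsto (fun N => eLpNorm (gridStep h (N + 1) - h) 1 (cube m)) atTop (𝓝 0) := by
    simp_rw [eLpNorm_one_eq_lintegral_enorm]
    rw [← lintegral_zero (μ := cube m)]
    refine tendsto_lintegral_of_dominated_convergence (fun _ => ENNReal.ofReal (2 * M))
      (fun N => ((measurable_gridStep h _).sub hc.measurable).enorm) (fun N => ?_)
      (by rw [lintegral_const]; exact ENNReal.mul_ne_top ENNReal.ofReal_ne_top (measure_ne_top _ _))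
      ?_
    · filter_upwards [hstep N] with t ht
      rw [← ofReal_norm]
      refine ENNReal.ofReal_le_ofReal ((norm_sub_le _ _).trans ?_)
      have := abs_truncate_le hM0 (g t)
      simp only [Real.norm_eq_abs]
      change _ + |truncate M (g t)| ≤ _
      linarith
    · filter_upwards [ae_mem_cube (ι := Fin m)] with t ht
      have h1 := ((tendsto_gridStep hc t ht).comp (tendsto_add_atTop_nat 1)).sub_const (h t)
      rw [sub_self] at h1
      have := (continuous_enorm.tendsto (0:ℝ)).comp h1
      rwa [enorm_zero] at this
  obtain ⟨N, hN⟩ := (hlim.eventually (gt_mem_nhds (pos_iff_ne_zero.2 hε2))).exists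
  refine ⟨h, N + 1, hstep N, ?_⟩
  have : gridStep h (N + 1) - f = (gridStep h (N + 1) - h) + (h - f) := by abel
  rw [this]
  refine (eLpNorm_add_le ((measurable_gridStep h _).sub hc.measurable).aestronglyMeasurable
    (hc.measurable.sub hf).aestronglyMeasurable le_rfl).trans ?_
  exact (add_le_add hN.le hfh).trans (ENNReal.add_halves ε).le

/-- A bounded symmetric function is an almost everywhere limit of bounded tensor polynomials. -/
theorem exists_tendsto_tensorPoly {H : ℝ} (hH : 1 / 2 < H) {m : ℕ} {f : (Fin m → ℝ) → ℝ}
    (hf : Measurable f) (hsymm : ∀ t (σ : Equiv.Perm (Fin m)), f (t ∘ σ) = f t) {M : ℝ}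
    (hM : ∀ t, |f t| ≤ M) :
    ∃ c : ℕ → (AbsH H →₀ ℝ), (∀ j, ∀ᵐ t ∂cube m, |tensorPoly m (c j) t| ≤ M) ∧
      ∀ᵐ t ∂cube m, Tendsto (fun j => tensorPoly m (c j) t) atTop (𝓝 (f t)) := by
  have hex : ∀ j : ℕ, ∃ (h : (Fin m → ℝ) → ℝ) (N : ℕ),
      (∀ᵐ t ∂cube m, |gridStep h N t| ≤ M) ∧
        eLpNorm (gridStep h N - f) 1 (cube m) ≤ ((j : ENNReal) + 1)⁻¹ := fun j =>
    exists_gridStep_eLpNorm_le hf hM (ENNReal.inv_ne_zero.2 (by simp))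
  choose h N hb hL using hex
  have hconv : Tendsto (fun j => eLpNorm (gridStep (h j) (N j) - f) 1 (cube m)) atTop (𝓝 0) := by
    refine tendsto_of_tendsto_of_tendsto_of_le_of_le tendsto_const_nhds ?_ (fun _ => zero_le) hL
    refine (ENNReal.tendsto_inv_nat_nhds_zero.comp (tendsto_add_atTop_nat 1)).congr fun j => ?_
    simp
  -- Convergence in $L^1$ gives an almost everywhere convergent subsequence. Symmetrizing it keeps
  -- the bound and the limit, since $f$ is symmetric and the cube measure is invariant under
  -- permutations.
  obtain ⟨ns, -, hns⟩ := (tendstoInMeasure_of_tendsto_eLpNorm one_ne_zero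
    (fun j => (measurable_gridStep (h j) (N j)).aestronglyMeasurable) hf.aestronglyMeasurable
    hconv).exists_seq_tendsto_ae
  have hperm : ∀ {p : (Fin m → ℝ) → Prop}, (∀ᵐ t ∂cube m, p t) →
      ∀ᵐ t ∂cube m, ∀ σ : Equiv.Perm (Fin m), p (t ∘ σ) := fun {p} hp => by
    rw [ae_all_iff]
    exact fun σ => (measurePreserving_comp_equiv unitMeas σ).quasiMeasurePreserving.ae hp
  have hfact : (0:ℝ) < m.factorial := by positivity
  choose c hc using fun j => isTensorPoly_symmetrize_gridStep hH (h (ns j)) (N (ns j))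
  refine ⟨c, fun j => ?_, ?_⟩
  · filter_upwards [hperm (hb (ns j))] with t ht
    rw [hc]
    unfold symmetrize
    rw [abs_mul, abs_of_pos (inv_pos.2 hfact), inv_mul_le_iff₀ hfact]
    refine (Finset.abs_sum_le_sum_abs _ _).trans ((Finset.sum_le_sum fun σ _ => ht σ).trans ?_)
    simp [Fintype.card_perm]
  · filter_upwards [hperm hns] with t ht
    simp_rw [hc]
    have h1 := (tendsto_finsetSum Finset.univ fun (σ : Equiv.Perm (Fin m)) _ => ht σ).const_mul
      ((m.factorial : ℝ))⁻¹
    have h2 := symmetrize_of_symmetric f hsymm t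
    unfold symmetrize at h2
    rw [h2] at h1
    exact h1

/-- A symmetric function with finite trace norms is a limit of tensor polynomials in all trace
norms. -/
theorem exists_tendsto_traceNormSq {H : ℝ} (hH : 1 / 2 < H) (hH' : H < 1) {m : ℕ}
    {f : (Fin m → ℝ) → ℝ} (hf : Measurable f)
    (hsymm : ∀ t (σ : Equiv.Perm (Fin m)), f (t ∘ σ) = f t)
    (hfin : ∀ l, traceNormSq H m l f ≠ ⊤) :
    ∃ c : ℕ → (AbsH H →₀ ℝ), ∀ l,
      Tendsto (fun j => traceNormSq H m l fun t => tensorPoly m (c j) t - f t) atTop (𝓝 0) := by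
  let F : ℕ → (Fin m → ℝ) → ℝ := fun n t => truncate n (f t)
  have hF : ∀ n, Measurable (F n) := fun n => (measurable_truncate _).comp hf
  have hFb : ∀ n t, |F n t| ≤ n := fun n t => abs_truncate_le n.cast_nonneg _
  have hFf : ∀ l, Tendsto (fun n => traceNormSq H m l fun t => F n t - f t) atTop (𝓝 0) := by
    intro l
    refine tendsto_traceNormSq_zero H l (fun n => (hF n).sub hf) hf (hfin l)
      (fun n => ae_of_all _ fun t => ?_) (ae_of_all _ fun t => ?_)
    · rw [abs_sub_comm]
      exact abs_sub_truncate_le_abs n.cast_nonneg _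
    · refine tendsto_const_nhds.congr' ?_
      obtain ⟨n₀, hn₀⟩ := exists_nat_ge |f t|
      filter_upwards [eventually_ge_atTop n₀] with n hn
      have : truncate n (f t) = f t :=
        truncate_eq_self (hn₀.trans (by exact_mod_cast hn))
      simp only [F, this, sub_self]
  -- Only finitely many trace norms are nontrivial, so one tensor polynomial serves all of them. The
  -- truncation and its approximations are bounded by $n$, so the constant $2n$ dominates their
  -- difference.
  have hstep : ∀ n : ℕ, ∃ c : AbsH H →₀ ℝ, ∀ l,
      traceNormSq H m l (fun t => tensorPoly m c t - F n t) ≤ ((n : ENNReal) + 1)⁻¹ := by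
    intro n
    obtain ⟨c, hcb, hcl⟩ := exists_tendsto_tensorPoly hH (hF n)
      (fun t σ => by simp only [F, hsymm]) (hFb n)
    have hl : ∀ l, Tendsto (fun j => traceNormSq H m l fun t => tensorPoly m (c j) t - F n t)
        atTop (𝓝 0) := by
      intro l
      refine tendsto_traceNormSq_zero H l (fun j => (measurable_tensorPoly m (c j)).sub (hF n))
        measurable_const (traceNormSq_const_ne_top hH m l (2 * n)) (fun j => ?_) ?_
      · filter_upwards [hcb j] with t ht
        rw [abs_of_nonneg (by positivity : (0:ℝ) ≤ 2 * n)]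
        refine (abs_sub _ _).trans ?_
        linarith [hFb n t]
      · filter_upwards [hcl] with t ht
        simpa using ht.sub_const (F n t)
    have hpos : (0 : ENNReal) < ((n : ENNReal) + 1)⁻¹ := ENNReal.inv_pos.2 (by simp)
    have hev : ∀ᶠ j in atTop, ∀ l ∈ Finset.range (m + 1),
        traceNormSq H m l (fun t => tensorPoly m (c j) t - F n t) < ((n : ENNReal) + 1)⁻¹ :=
      (Finset.eventually_all _).2 fun l _ => (hl l).eventually (gt_mem_nhds hpos)
    obtain ⟨j, hj⟩ := hev.exists
    refine ⟨c j, fun l => ?_⟩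
    by_cases hlm : l ∈ Finset.range (m + 1)
    · exact (hj l hlm).le
    · rw [traceNormSq_of_lt H (by simp at hlm; omega)]
      exact zero_le
  choose c hc using hstep
  refine ⟨c, fun l => ?_⟩
  have hb : ∀ n, traceNormSq H m l (fun t => tensorPoly m (c n) t - f t) ≤
      (1 + (1 : NNReal)) * ((n : ENNReal) + 1)⁻¹ +
        (1 + ((1 : NNReal)⁻¹ : NNReal)) * traceNormSq H m l (fun t => F n t - f t) := by
    intro n
    have h := traceNormSq_add_le hH' m l (fun t => tensorPoly m (c n) t - F n t)
      (fun t => F n t - f t) ((measurable_tensorPoly m (c n)).sub (hF n)) ((hF n).sub hf)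
      (ε := 1) one_ne_zero
    simp only [sub_add_sub_cancel] at h
    exact h.trans (by gcongr; exact hc n l)
  have hinv : Tendsto (fun n : ℕ => ((n : ENNReal) + 1)⁻¹) atTop (𝓝 0) := by
    refine (ENNReal.tendsto_inv_nat_nhds_zero.comp (tendsto_add_atTop_nat 1)).congr fun j => ?_
    simp
  have hlim := (ENNReal.Tendsto.const_mul hinv (.inr (by simp) :
    (0 : ENNReal) ≠ 0 ∨ (1 + ((1 : NNReal) : ENNReal)) ≠ ⊤)).add
    (ENNReal.Tendsto.const_mul (hFf l) (.inr (by simp) :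
    (0 : ENNReal) ≠ 0 ∨ (1 + (((1 : NNReal)⁻¹ : NNReal) : ENNReal)) ≠ ⊤))
  rw [mul_zero, mul_zero, add_zero] at hlim
  exact tendsto_of_tendsto_of_tendsto_of_le_of_le tendsto_const_nhds hlim (fun _ => zero_le) hb

/-! ### The main bound -/

/-- Whatever $l$ is, the two halves together carry $2m$ coordinates arranged in $m$ pairs, so
merging them always leads to the same full trace. The independence of $l$ is what lets the Wick
weights be summed. -/
theorem RenewalLaw.traceNormSq_psi_le (R : RenewalLaw) (H : ℝ) (m k l : ℕ) :
    traceNormSq H m l (R.psi m k) ≤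
      ∫⁻ s, R.psiExt (2 * m) (2 * k) s * ENNReal.ofReal (pairKernel H m s) ∂cube (2 * m) := by
  rcases lt_or_ge m (2 * l) with h | h
  · rw [traceNormSq_of_lt H h]; exact zero_le
  obtain ⟨r, rfl⟩ := Nat.exists_eq_add_of_le h
  rw [traceNormSq_self]
  refine absTraceNormSq_le rfl _ (R.measurable_psi _ _) _ (R.measurable_psiExt _ _) fun σ c hc => ?_
  exact (mul_le_mul' (R.enorm_psi_le _ _ _) (R.enorm_psi_le _ _ _)).trans
    (R.psiExt_mul_psiExt_le σ (evenOdd k) c hc)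

theorem wickNormSq_le {H : ℝ} {m : ℕ} {f : (Fin m → ℝ) → ℝ} {B : ENNReal}
    (hB : ∀ l, traceNormSq H m l f ≤ B) :
    wickNormSq H m f ≤ ENNReal.ofReal (2 ^ m * ((m + 1).factorial : ℝ)) * B := by
  unfold wickNormSq
  refine (Finset.sum_le_sum fun l _ => mul_le_mul_right (hB l) _).trans ?_
  rw [← Finset.sum_mul, ← ENNReal.ofReal_sum_of_nonneg fun l _ => wickWeight_nonneg m l,
    sum_wickWeight]
  gcongr
  exact_mod_cast doubleFactorial_odd_le m

theorem traceIntegrand_zero (H : ℝ) (m : ℕ) (f : (Fin (2 * m) → ℝ) → ℝ) (s : Fin (2 * m) → ℝ) :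
    traceIntegrand H m 0 f ![] s = f s * pairKernel H m s := by
  unfold traceIntegrand
  congr 2
  ext i
  exact Fin.append_left s ![] i

theorem RenewalLaw.traceIntegrand_psi_ae_eq (R : RenewalLaw) (H : ℝ) (m k : ℕ) :
    ∀ᵐ s ∂cube (2 * m), traceIntegrand H m 0 (R.psi (2 * m) k) ![] s =
      (R.psiExt (2 * m) k s * ENNReal.ofReal (pairKernel H m s)).toReal := by
  filter_upwards [ae_mem_cube (ι := Fin (2 * m))] with s hs
  rw [traceIntegrand_zero, R.psi_eq_toReal _ _ _ hs, ENNReal.toReal_mul,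
    ENNReal.toReal_ofReal (pairKernel_nonneg _ _ _)]

theorem RenewalLaw.integrable_traceIntegrand_psi (R : RenewalLaw) {H : ℝ} (hH : 1 / 2 < H)
    (hH' : H < 1) (hA : 2 < R.α + 2 * H) (m k : ℕ) :
    Integrable (traceIntegrand H m 0 (R.psi (2 * m) k) ![]) (cube (2 * m)) ∧
      ENNReal.ofReal (trace H m 0 (R.psi (2 * m) k) ![]) =
        ∫⁻ s, R.psiExt (2 * m) k s * ENNReal.ofReal (pairKernel H m s) ∂cube (2 * m) := by
  have hB := R.lintegral_psiExt_mul_lt_top hH hH' hA m k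
  have hm : Measurable fun s => R.psiExt (2 * m) k s * ENNReal.ofReal (pairKernel H m s) := by
    fun_prop
  have hae := R.traceIntegrand_psi_ae_eq H m k
  refine ⟨(integrable_toReal_of_lintegral_ne_top hm.aemeasurable hB.ne).congr
    (hae.mono fun s hs => hs.symm), ?_⟩
  unfold trace
  rw [integral_congr_ae hae, integral_toReal hm.aemeasurable (ae_lt_top hm hB.ne),
    ENNReal.ofReal_toReal hB.ne]

theorem stratonovich_psi {Ω : Type*} [MeasurableSpace Ω] (P : Measure Ω) [IsProbabilityMeasure P]
    (R : RenewalLaw) (H : ℝ) (hH : 1 / 2 < H) (hH' : H < 1) (hA : 2 < R.α + 2 * H)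
    (W : AbsH H → Ω → ℝ) (hW : IsIsonormal P H W) (m k : ℕ) :
    (∃ X, IsStratonovichIntegral P W m (R.psi m k) X) ∧
      Integrable (traceIntegrand H m 0 (R.psi (2 * m) (2 * k)) ![]) (cube (2 * m)) ∧
      ∀ X, IsStratonovichIntegral P W m (R.psi m k) X →
        ∫ ω, X ω ^ 2 ∂P ≤
          2 ^ m * ((m + 1).factorial : ℝ) * trace H m 0 (R.psi (2 * m) (2 * k)) ![] := by
  have hB := R.lintegral_psiExt_mul_lt_top hH hH' hA m (2 * k)
  obtain ⟨hint, htr⟩ := R.integrable_traceIntegrand_psi hH hH' hA m (2 * k)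
  have hm := R.measurable_psi m k
  refine ⟨?_, hint, fun X hX => ?_⟩
  · obtain ⟨c, hc⟩ := exists_tendsto_traceNormSq hH hH' hm (fun t σ => R.psi_comp_perm t σ)
      fun l => ((R.traceNormSq_psi_le H m k l).trans_lt hB).ne
    exact hW.exists_isStratonovichIntegral hH' hm c hc
  · have h := (hX.integral_sq_le hW hH' hm).trans
      (wickNormSq_le fun l => R.traceNormSq_psi_le H m k l)
    rw [← htr, ← ENNReal.ofReal_mul (by positivity)] at h
    -- Returning from $[0,\infty]$ to real numbers requires a nonnegative right side, that is, a
    -- nonnegative trace.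
    refine (ENNReal.ofReal_le_ofReal_iff ?_).1 h
    refine mul_nonneg (by positivity) ?_
    unfold trace
    rw [integral_congr_ae (R.traceIntegrand_psi_ae_eq H m (2 * k))]
    exact integral_nonneg fun s => ENNReal.toReal_nonneg

end Pinning

end

theorem lemma4p3 {Ω : Type*} [MeasurableSpace Ω] (P : Measure Ω) [IsProbabilityMeasure P]
    (R : Pinning.RenewalLaw) (H : ℝ) (hH : 1 / 2 < H) (hH' : H < 1) (hA : 2 < R.α + 2 * H)
    (W : Pinning.AbsH H → Ω → ℝ) (hW : Pinning.IsIsonormal P H W) (m k : ℕ) :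
    ((∃ X, Pinning.IsStratonovichIntegral P W m (R.phi m) X) ∧
      Integrable (Pinning.traceIntegrand H m 0 (R.phi (2 * m)) ![]) (Pinning.cube (2 * m)) ∧
      ∀ X, Pinning.IsStratonovichIntegral P W m (R.phi m) X →
        ∫ ω, X ω ^ 2 ∂P ≤
          2 ^ m * ((m + 1).factorial : ℝ) * Pinning.trace H m 0 (R.phi (2 * m)) ![]) ∧
    ((∃ X, Pinning.IsStratonovichIntegral P W m (R.psi m k) X) ∧
      Integrable (Pinning.traceIntegrand H m 0 (R.psi (2 * m) (2 * k)) ![])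
        (Pinning.cube (2 * m)) ∧
      ∀ X, Pinning.IsStratonovichIntegral P W m (R.psi m k) X →
        ∫ ω, X ω ^ 2 ∂P ≤
          2 ^ m * ((m + 1).factorial : ℝ) *
            Pinning.trace H m 0 (R.psi (2 * m) (2 * k)) ![]) := by
  refine ⟨?_, Pinning.stratonovich_psi P R H hH hH' hA W hW m k⟩
  -- With no extra variables $\psi_{m,0}=\phi_m$, so the claim for $\phi$ is the case $k=0$.
  have h := Pinning.stratonovich_psi P R H hH hH' hA W hW m 0
  rw [mul_zero, R.psi_zero, R.psi_zero] at h
  exact h
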